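/- Let $c>0$ and write $L^2=L^2(\mathbb R^3)\otimes\mathbb R^3$. Let $\mathbf E_0,\mathbf B_0\in L^2$, $\rho\in C(\mathbb R,L^2(\mathbb R^3))$ and $\mathbf j\in C(\mathbb R,L^2)$ be real-valued and satisfy, in the sense of distributions, $$\operatorname{div}\mathbf E_0=4\pi\rho(0),\qquad \operatorname{div}\mathbf B_0=0 \quad\text{on }\mathbb R^3,\qquad \dot\rho+\operatorname{div}\mathbf j=0\quad\text{on }\mathbb R\times\mathbb R^3 .$$ Consider the Cauchy problem for the Maxwell equations (in the sense of distributions on $\mathbb R\times\mathbb R^3$) $$\operatorname{div}\mathbf E=4\pi\rho,\quad \operatorname{rot}\mathbf E=-\tfrac1c\dot{\mathbf B},\quad \operatorname{div}\mathbf B=0,\quad \operatorname{rot}\mathbf B=\tfrac{4\pi}c\,\mathbf j+\tfrac1c\dot{\mathbf E},\qquad \mathbf E|_{t=0}=\mathbf E_0,\ \ \mathbf B|_{t=0}=\mathbf B_0 .$$ Then: i) The Cauchy problem has a unique solution $(\mathbf E,\mathbf B)\in C(\mathbb R,L^2\oplus L^2)$. ii) If $\mathbf j\equiv0$, the energy is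 conserved: $\int_{\mathbb R^3}\big[|\mathbf E(t,x)|^2+|\mathbf B(t,x)|^2\big]\,dx=\int_{\mathbb R^3}\big[|\mathbf E_0(x)|^2+|\mathbf B_0(x)|^2\big]\,dx$ for all $t\in\mathbb R$. iii) Let $K(t)=\frac1{4\pi t}\,\delta(|x|-|t|)$ be the Kirchhoff kernel, i.e. $\langle K(t),\varphi\rangle=\frac1{4\pi t}\int_{|x|=|t|}\varphi\,dS$ for $t\ne0$, and $K(0)=0$. For every test function $\varphi$ the function $t\mapsto\langle K(t),\varphi\rangle$ is differentiable on $\mathbb R$, and its derivative at $t$ is $\langle\partial_tK(t),\varphi\rangle$ for a distribution $\partial_tK(t)$. Put $$\mathbf M(t)=\begin{pmatrix}(\partial_tK)(ct)&\operatorname{rot}\circ K(ct)\\-\operatorname{rot}\circ K(ct)&(\partial_tK)(ct)\end{pmatrix},\qquad \mathbf G(t)=c\begin{pmatrix}-\nabla K(ct)&-(\partial_tK)(ct)\\0&\operatorname{rot}\circ K(ct)\end{pmatrix},$$ where $\operatorname{rot}\circ K$ is the $3\times3$ matrix of distributions with $(\operatorname{rot}\circ K)*\mathbf F=\operatorname{rot}(K*\mathbf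 F)$. For every $t\in\mathbb R$, the $6\times6$ resp. $6\times4$ matrix-valued distributions $\mathbf M(t)$ and $\mathbf G(t)$ are concentrated on the sphere $|x|=c|t|$, i.e. they vanish on the open set $\{|x|\ne c|t|\}$, and $$\begin{pmatrix}\mathbf E(t)\\\mathbf B(t)\end{pmatrix}=\mathbf M(t)*\begin{pmatrix}\mathbf E_0\\\mathbf B_0\end{pmatrix}+4\pi\int_0^t\mathbf G(t-s)*\begin{pmatrix}\rho(s)\\\frac1c\,\mathbf j(s)\end{pmatrix}ds,\qquad t\in\mathbb R,$$ as distributions on $\mathbb R^3$ (the integral in $s$ being taken after pairing with a test function, where the integrand is integrable on $[0,t]$). -/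

import Mathlib

open MeasureTheory TopologicalSpace
open scoped Distributions LineDeriv ENNReal

noncomputable section

namespace Maxwell

/-- Physical space `ℝ³` with the Euclidean norm. -/
abbrev Space : Type := EuclideanSpace ℝ (Fin 3)

/-- `L²(ℝ³)`, real valued. -/
abbrev L2 : Type := Lp ℝ 2 (volume : Measure Space)

/-- `L²(ℝ³) ⊗ ℝ³`, vector valued. -/
abbrev L2V : Type := Lp Space 2 (volume : Measure Space)

/-- Test functions on `ℝ³`. -/
abbrev Test : Type := 𝓓((⊤ : Opens Space), ℝ)

/-- Distributions on `ℝ³`. -/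
abbrev Dist : Type := 𝓓'((⊤ : Opens Space), ℝ)

/-- Test functions on space-time `ℝ × ℝ³`. -/
abbrev STTest : Type := 𝓓((⊤ : Opens (ℝ × Space)), ℝ)

/-- Standard basis vector of `ℝ³`. -/
abbrev e (i : Fin 3) : Space := EuclideanSpace.single i 1

/-! ### Distributional derivatives of time-dependent fields -/

/-- The value at `φ` of the distribution on `ℝ × ℝ³` given by the function `u(t, x)`. -/
def pair (u : ℝ → Space → ℝ) (φ : STTest) : ℝ := ∫ t, ∫ x, u t x * φ (t, x)

/-- `⟨∂ₜ u, φ⟩`. -/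
def dt (u : ℝ → Space → ℝ) (φ : STTest) : ℝ := -pair u (∂_{((1 : ℝ), (0 : Space))} φ)

/-- `⟨∂u/∂xᵢ, φ⟩`. -/
def dx (i : Fin 3) (u : ℝ → Space → ℝ) (φ : STTest) : ℝ := -pair u (∂_{((0 : ℝ), e i)} φ)

/-- The `i`-th component of a vector field. -/
def comp (F : ℝ → L2V) (i : Fin 3) : ℝ → Space → ℝ := fun t x => F t x i

/-- `⟨div F, φ⟩`. -/
def divST (F : ℝ → L2V) (φ : STTest) : ℝ := ∑ i, dx i (comp F i) φ

/-- `⟨(rot F)ᵢ, φ⟩`; the indices of `Fin 3` are cyclic. -/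
def rotST (F : ℝ → L2V) (i : Fin 3) (φ : STTest) : ℝ :=
  dx (i + 1) (comp F (i + 2)) φ - dx (i + 2) (comp F (i + 1)) φ

/-- The Maxwell equations in Gaussian units, in the sense of distributions on `ℝ × ℝ³`. -/
structure Equations (c : ℝ) (ρ : ℝ → L2) (j E B : ℝ → L2V) : Prop where
  divE : ∀ φ, divST E φ = 4 * Real.pi * pair (fun t => ρ t) φ
  rotE : ∀ i φ, rotST E i φ = -(1 / c) * dt (comp B i) φ
  divB : ∀ φ, divST B φ = 0
  rotB : ∀ i φ, rotST B i φ = 4 * Real.pi / c * pair (comp j i) φ + 1 / c * dt (comp E i) φ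

/-- The Cauchy problem: `u = (E, B)` solves the Maxwell equations and `u(0) = (E₀, B₀)`. -/
structure IsSolution (c : ℝ) (E₀ B₀ : L2V) (ρ : C(ℝ, L2)) (j : C(ℝ, L2V))
    (u : C(ℝ, L2V × L2V)) : Prop where
  equations : Equations c ρ j (fun t => (u t).1) (fun t => (u t).2)
  initial : u 0 = (E₀, B₀)

/-- Charge continuity `∂ₜρ + div j = 0` in the sense of distributions on `ℝ × ℝ³`. -/
def ChargeContinuity (ρ : ℝ → L2) (j : ℝ → L2V) : Prop :=
  ∀ φ, dt (fun t => ρ t) φ + divST j φ = 0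

/-- `div F = f` in the sense of distributions on `ℝ³`. -/
def HasDiv (F : L2V) (f : Space → ℝ) : Prop :=
  ∀ φ : Test, -∑ i, ∫ x, F x i * (∂_{e i} φ) x = ∫ x, f x * φ x

/-! ### The Kirchhoff kernel -/

/-- Surface measure of the sphere `|x| = r`, `r ≥ 0`. -/
def surfaceMeasure (r : ℝ) : Measure Space :=
  ENNReal.ofReal (r ^ 2) •
    (volume : Measure Space).toSphere.map (fun ω : Metric.sphere (0 : Space) 1 => r • (ω : Space))

instance (r : ℝ) : IsFiniteMeasure (surfaceMeasure r) := by
  unfold surfaceMeasure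
  exact Measure.smul_finite _ ENNReal.ofReal_ne_top

/-- The distribution `δ(|x| - r)`, for `r ≥ 0`. -/
def deltaSphere (r : ℝ) : Dist where
  toFun φ := ∫ x, φ x ∂surfaceMeasure r
  map_add' φ ψ := by
    have h (χ : Test) : Integrable χ (surfaceMeasure r) :=
      χ.continuous.integrable_of_hasCompactSupport χ.hasCompactSupport
    simpa using integral_add (h φ) (h ψ)
  map_smul' a φ := by
    simpa using integral_const_mul (μ := surfaceMeasure r) a φ
  cont := by
    have h : LocallyIntegrableOn (fun _ : Space => (1 : ℝ)) ((⊤ : Opens Space) : Set Space)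
        (surfaceMeasure r) := (integrable_const 1).locallyIntegrable.locallyIntegrableOn _
    have hc := (TestFunction.integralAgainstBilinCLM (n := ⊤) (Ω := (⊤ : Opens Space))
      (ContinuousLinearMap.mul ℝ ℝ) (surfaceMeasure r) (fun _ => (1 : ℝ))).continuous
    refine hc.congr fun φ => ?_
    rw [TestFunction.integralAgainstBilinCLM_eq_integral h]
    simp

/-- The Kirchhoff kernel `K(t, x) = δ(|x| - |t|) / (4πt)`; it vanishes for `t = 0`. -/
def K (t : ℝ) : Dist := (4 * Real.pi * t)⁻¹ • deltaSphere |t|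

open Classical in
/-- The derivative in `t` of a family of distributions, in the weak sense. -/
def timeDeriv (T : ℝ → Dist) (t : ℝ) : Dist :=
  if h : ∃ D : Dist, ∀ φ : Test, HasDerivAt (fun τ => T τ φ) (D φ) t then h.choose else 0

/-- The matrix of the operator `rot ∘ T`, i.e. `rot (T * F) = (rot ∘ T) * F`. -/
def rotMat (T : Dist) : Matrix (Fin 3) (Fin 3) Dist :=
  !![0, -∂_{e 2} T, ∂_{e 1} T;
     ∂_{e 2} T, 0, -∂_{e 0} T;
     -∂_{e 1} T, ∂_{e 0} T, 0]

/-- The `6 × 6` matrix distribution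
`M(t) = ((∂ₜK)(ct), rot ∘ K(ct); -rot ∘ K(ct), (∂ₜK)(ct))`. -/
def M (c t : ℝ) : Matrix (Fin 3 ⊕ Fin 3) (Fin 3 ⊕ Fin 3) Dist :=
  Matrix.fromBlocks (Matrix.diagonal fun _ => timeDeriv K (c * t)) (rotMat (K (c * t)))
    (-rotMat (K (c * t))) (Matrix.diagonal fun _ => timeDeriv K (c * t))

/-- The `6 × 4` matrix distribution
`G(t) = c (-∇K(ct), -(∂ₜK)(ct); 0, rot ∘ K(ct))`. -/
def G (c t : ℝ) : Matrix (Fin 3 ⊕ Fin 3) (Unit ⊕ Fin 3) Dist :=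
  c • Matrix.fromBlocks (Matrix.of fun i _ => -∂_{e i} (K (c * t)))
    (-Matrix.diagonal fun _ => timeDeriv K (c * t)) 0 (rotMat (K (c * t)))

/-! ### Convolution -/

/-- The test function `x ↦ φ(x + y)`. -/
def shift (y : Space) (φ : Test) : Test where
  toFun x := φ (x + y)
  contDiff' := φ.contDiff.comp (contDiff_id.add contDiff_const)
  hasCompactSupport' := φ.hasCompactSupport.comp_homeomorph (Homeomorph.addRight y)
  tsupport_subset' := fun _ _ => trivial

/-- `⟨T * f, φ⟩ = ∫ f(y) ⟨T, φ(· + y)⟩ dy`, for a distribution `T` with compact support and a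
locally integrable function `f`. -/
def conv (T : Dist) (f : Space → ℝ) (φ : Test) : ℝ := ∫ y, f y * T (shift y φ)

/-- `⟨(A * f)ᵢ, φ⟩` for a matrix `A` of distributions and a vector `f` of functions. -/
def matConv {m n : Type} [Fintype n] (A : Matrix m n Dist) (f : n → Space → ℝ) (i : m)
    (φ : Test) : ℝ := ∑ k, conv (A i k) (f k) φ

/-- The six-component vector `(E, B)`. -/
def fieldVec (u : L2V × L2V) : Fin 3 ⊕ Fin 3 → Space → ℝ :=
  Sum.elim (fun i x => u.1 x i) (fun i x => u.2 x i)

/-- The four-component vector `(ρ, j / c)`. -/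
def sourceVec (c : ℝ) (ρ : L2) (j : L2V) : Unit ⊕ Fin 3 → Space → ℝ :=
  Sum.elim (fun _ x => ρ x) (fun i x => 1 / c * j x i)

end Maxwell

end

/-! The Maxwell equations are embedded in a symmetric first order system for eight unknowns, the
fields E, B and two scalars f, g: ∂ₜE = c(rot B - ∇f) - 4πj, ∂ₜB = -c(rot E + ∇g), ∂ₜf = -c div E +
4πcρ, ∂ₜg = -c div B. Its solutions with f = g = 0 are exactly the solutions of all four Maxwell
equations, the divergence equations included (`equations_iff`). Write the system as ∂ₜV = cDV + S
with D = ∑ Aᵢ∂ᵢ. The matrices Aᵢ are symmetric, so D is formally skew-adjoint in L²; they satisfy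
the Clifford relations, so D² = Δ (`isClifford_maxwellMat`).

Since D² = Δ, the propagator is explicit on test functions: exp(ctD) = (∂ₜK)(ct) + D K(ct), where
K(t) maps ψ to the solution of the wave equation with data 0 and ψ (`pderiv_time_flow`). That t
times the spherical mean solves the wave equation is derived from the rotation invariance of the
sphere measure alone (`pderiv_time_time_kirchhoff`). Skewness makes this flow isometric, so it
extends to a strongly continuous unitary group `U` on L², and Duhamel's formula yields a weak
solution for every continuous source.

Conversely, a weak solution tested against the classical flow run backwards from time t leaves only
the initial value and the source (`IsWeakSolution.inner_testH`). This gives uniqueness, and for a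
test tuple with one nonzero entry it is the convolution formula: `M` and `G` consist of entries of
the propagator.

For existence it remains to see that f and g vanish along Duhamel's solution. For f, charge
continuity tested with a Kirchhoff solution cancels the initial Gauss law
(`duhamel_charge_eq_zero`). Energy conservation follows from d/dt ‖V‖² = 2⟨V, S⟩: when j = 0 the
source has only an f component, where V vanishes. The kernels live on the sphere because K, its
gradient and ∂ₜK only see a test function and its first derivatives there. -/

noncomputable section

namespace Maxwell

open scoped ContDiff

section

open scoped Pointwise

/-! ### The rotation invariant measure on the unit sphere -/

/-- Surface measure of the unit sphere, as a measure on `ℝ³`. -/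
def sphereMeasure : Measure Space :=
  (volume : Measure Space).toSphere.map (fun z : Metric.sphere (0 : Space) 1 => (z : Space))

instance : IsFiniteMeasure sphereMeasure := by
  unfold sphereMeasure; infer_instance

lemma ae_norm_eq_one : ∀ᵐ y ∂sphereMeasure, ‖y‖ = 1 := by
  unfold sphereMeasure
  rw [ae_map_iff measurable_subtype_coe.aemeasurable
    (measurableSet_eq_fun measurable_norm measurable_const)]
  exact Filter.Eventually.of_forall fun z => by simp

/-- The measure of `s` is three times the volume of the cone over `s` in the unit ball, and linear
isometries map cones to cones and preserve volume. -/
lemma sphereMeasure_map (L : Space ≃ₗᵢ[ℝ] Space) : sphereMeasure.map L = sphereMeasure := by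
  have key (s : Set Space) (hs : MeasurableSet s) : sphereMeasure s =
      3 * volume (Set.Ioo (0 : ℝ) 1 • (Metric.sphere (0 : Space) 1 ∩ s)) := by
    unfold sphereMeasure
    rw [Measure.map_apply measurable_subtype_coe hs,
      Measure.toSphere_apply' _ (measurable_subtype_coe hs), Subtype.image_preimage_coe]
    simp
  ext s hs
  rw [Measure.map_apply L.continuous.measurable hs, key _ (L.continuous.measurable hs), key _ hs]
  congr 1
  have hset : Set.Ioo (0 : ℝ) 1 • (Metric.sphere (0 : Space) 1 ∩ L ⁻¹' s) =
      L ⁻¹' (Set.Ioo (0 : ℝ) 1 • (Metric.sphere (0 : Space) 1 ∩ s)) := by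
    ext x
    simp only [Set.mem_smul, Set.mem_inter_iff, Set.mem_preimage, mem_sphere_zero_iff_norm]
    constructor
    · rintro ⟨r, hr, y, ⟨hy, hys⟩, rfl⟩
      exact ⟨r, hr, L y, ⟨by simpa using hy, hys⟩, by simp⟩
    · rintro ⟨r, hr, y, ⟨hy, hys⟩, hx⟩
      refine ⟨r, hr, L.symm y, ⟨by simpa using hy, by simpa using hys⟩, ?_⟩
      rw [← map_smul, hx, L.symm_apply_apply]
  rw [hset]
  exact (LinearIsometryEquiv.measurePreserving L).measure_preimage_equiv
    (f := L.toHomeomorph.toMeasurableEquiv) _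

lemma integral_sphereMeasure_comp (L : Space ≃ₗᵢ[ℝ] Space) (f : Space → ℝ) :
    ∫ y, f (L y) ∂sphereMeasure = ∫ y, f y ∂sphereMeasure := by
  conv_rhs => rw [← sphereMeasure_map L]
  exact (L.toHomeomorph.measurableEmbedding.integral_map f).symm

lemma integrable_sphereMeasure {f : Space → ℝ} (hf : Continuous f) :
    Integrable f sphereMeasure := by
  obtain ⟨C, hC⟩ := (isCompact_closedBall (0 : Space) 1).exists_bound_of_continuousOn hf.continuousOn
  refine Integrable.of_bound hf.aestronglyMeasurable C ?_
  filter_upwards [ae_norm_eq_one] with y hy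
  exact hC y (by simp [hy])

/-- Differentiation under the integral over the sphere. -/
lemma hasDerivAt_integral_sphereMeasure {h h' : ℝ → Space → ℝ}
    (hd : ∀ t y, HasDerivAt (fun s => h s y) (h' t y) t)
    (hc : ∀ t, Continuous (h t)) (hc' : Continuous fun p : ℝ × Space => h' p.1 p.2) (t : ℝ) :
    HasDerivAt (fun s => ∫ y, h s y ∂sphereMeasure) (∫ y, h' t y ∂sphereMeasure) t := by
  obtain ⟨C, hC⟩ := ((isCompact_Icc (a := t - 1) (b := t + 1)).prod
    (isCompact_closedBall (0 : Space) 1)).exists_bound_of_continuousOn hc'.continuousOn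
  refine (hasDerivAt_integral_of_dominated_loc_of_deriv_le (bound := fun _ => C)
    (Icc_mem_nhds (by linarith : t - 1 < t) (by linarith : t < t + 1))
    (Filter.Eventually.of_forall fun s => (hc s).aestronglyMeasurable)
    (integrable_sphereMeasure (hc t))
    (hc'.comp (Continuous.prodMk_right t)).aestronglyMeasurable ?_ (integrable_const C)
    (Filter.Eventually.of_forall fun y s _ => hd s y)).2
  filter_upwards [ae_norm_eq_one] with y hy s hs
  exact hC (s, y) ⟨hs, by simp [hy]⟩

/-- Integrals over the sphere depend smoothly on parameters. -/
lemma contDiff_integral_sphereMeasure {P : Type*} [NormedAddCommGroup P] [NormedSpace ℝ P]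
    {h : P → Space → ℝ} (hh : ContDiff ℝ ∞ fun q : P × Space => h q.1 q.2) :
    ContDiff ℝ ∞ fun p => ∫ y, h p y ∂sphereMeasure := by
  -- The bump is 1 on the unit sphere and 0 outside radius 2, so the integral is the convolution at
  -- 0 of the constant 1 with a compactly supported function. Convolution evaluates its second
  -- factor at `0 - y`, hence the sign in `g`.
  let b : ContDiffBump (0 : Space) := ⟨1, 2, one_pos, one_lt_two⟩
  let g : P → Space → ℝ := fun p y => h p (-y) * b y
  have hg : ContDiffOn ℝ ∞ (Function.HasUncurry.uncurry g) (Set.univ ×ˢ Set.univ) := by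
    refine ContDiff.contDiffOn ?_
    exact (hh.comp (contDiff_fst.prodMk contDiff_snd.neg)).mul (b.contDiff.comp contDiff_snd)
  have := contDiffOn_convolution_right_with_param_comp (n := ⊤) (μ := sphereMeasure)
    (ContinuousLinearMap.mul ℝ ℝ) (v := fun _ : P => (0 : Space)) contDiffOn_const
    (f := fun _ => (1 : ℝ)) (g := g) isOpen_univ (isCompact_closedBall (0 : Space) 2)
    (fun p x _ hx => by
      have : b x = 0 := b.zero_of_le_dist (by
        simp only [Metric.mem_closedBall, not_le] at hx
        exact hx.le)
      simp [g, this])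
    (integrable_const 1).locallyIntegrable hg
  rw [contDiffOn_univ] at this
  convert this using 2 with p
  rw [convolution_def]
  refine integral_congr_ae ?_
  filter_upwards [ae_norm_eq_one] with y hy
  have : b (-y) = 1 := b.one_of_mem_closedBall (by simp [b, hy])
  simp [g, this]

/-- Rotation by the angle `θ` in the plane spanned by `e i` and `e j`. -/
def rotation (i j : Fin 3) (hij : i ≠ j) (θ : ℝ) : Space ≃ₗᵢ[ℝ] Space :=
  LinearIsometry.toLinearIsometryEquiv
    { toFun := fun x => x + (Real.cos θ - 1) • (x i • e i + x j • e j)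
        + Real.sin θ • (x i • e j - x j • e i)
      map_add' := fun x y => by simp only [PiLp.add_apply]; module
      map_smul' := fun a x => by
        simp only [PiLp.smul_apply, smul_eq_mul, RingHom.id_apply]; module
      norm_map' := fun x => by
        have hs := Real.sin_sq_add_cos_sq θ
        refine (sq_eq_sq₀ (norm_nonneg _) (norm_nonneg _)).1 ?_
        rw [EuclideanSpace.real_norm_sq_eq, EuclideanSpace.real_norm_sq_eq]
        rw [Fin.sum_univ_three, Fin.sum_univ_three]
        fin_cases i <;> fin_cases j <;> simp at hij ⊢ <;>
          first
          | linear_combination (x 0 ^ 2 + x 1 ^ 2) * hs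
          | linear_combination (x 0 ^ 2 + x 2 ^ 2) * hs
          | linear_combination (x 1 ^ 2 + x 2 ^ 2) * hs } rfl

lemma rotation_apply (i j : Fin 3) (hij : i ≠ j) (θ : ℝ) (x : Space) :
    rotation i j hij θ x = x + (Real.cos θ - 1) • (x i • e i + x j • e j)
        + Real.sin θ • (x i • e j - x j • e i) := rfl

/-- The rotational vector fields integrate to zero over the sphere. -/
lemma integral_rotational_deriv (i j : Fin 3) (hij : i ≠ j) {f : Space → ℝ} (hf : ContDiff ℝ 1 f) :
    ∫ y, fderiv ℝ f y (y i • e j - y j • e i) ∂sphereMeasure = 0 := by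
  have hR (θ : ℝ) (y : Space) : HasDerivAt (fun s => rotation i j hij s y)
      ((-Real.sin θ) • (y i • e i + y j • e j) + Real.cos θ • (y i • e j - y j • e i)) θ := by
    simp only [rotation_apply]
    have h1 := (((Real.hasDerivAt_cos θ).sub_const 1).smul_const (y i • e i + y j • e j)).const_add y
    exact h1.add ((Real.hasDerivAt_sin θ).smul_const (y i • e j - y j • e i))
  have hcR : Continuous fun p : ℝ × Space => rotation i j hij p.1 p.2 := by
    simp only [rotation_apply]; fun_prop
  have hcR' : Continuous fun p : ℝ × Space => (-Real.sin p.1) • (p.2 i • e i + p.2 j • e j)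
        + Real.cos p.1 • (p.2 i • e j - p.2 j • e i) := by
    fun_prop
  -- By invariance the integral of `f` composed with the rotation by `θ` does not depend on `θ`; its
  -- derivative at `θ = 0` is the integral in question.
  have h := hasDerivAt_integral_sphereMeasure
    (fun θ y => ((hf.differentiable one_ne_zero) _).hasFDerivAt.comp_hasDerivAt θ (hR θ y))
    (fun t => hf.continuous.comp (rotation i j hij t).continuous)
    (((hf.continuous_fderiv one_ne_zero).comp hcR).clm_apply hcR') 0
  have hconst (s : ℝ) : ∫ y, (f ∘ fun s => rotation i j hij s y) s ∂sphereMeasure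
      = ∫ y, f y ∂sphereMeasure :=
    integral_sphereMeasure_comp (rotation i j hij s) f
  simp only [hconst] at h
  have := h.unique (hasDerivAt_const _ _)
  have h0 (y : Space) : rotation i j hij 0 y = y := by simp [rotation_apply]
  simpa only [h0, Real.sin_zero, Real.cos_zero, neg_zero, zero_smul, one_smul, zero_add] using this

end

section

/-! ### Smooth curves of test functions -/

/-- The derivative in the direction `v` of a function of time and space. -/
def pderiv (v : ℝ × Space) (F : ℝ → Space → ℝ) (t : ℝ) (x : Space) : ℝ :=
  fderiv ℝ (fun p : ℝ × Space => F p.1 p.2) (t, x) v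

/-- The direction of time. -/
abbrev timeDir : ℝ × Space := (1, 0)

/-- The direction of the `i`-th coordinate of space. -/
abbrev spaceDir (i : Fin 3) : ℝ × Space := (0, e i)

/-- Smooth functions of time and space whose supports in space are locally uniformly bounded. -/
structure IsTestCurve (F : ℝ → Space → ℝ) : Prop where
  smooth : ContDiff ℝ ∞ fun p : ℝ × Space => F p.1 p.2
  bounded : ∀ T : ℝ, ∃ R : ℝ, ∀ t x, |t| ≤ T → R < ‖x‖ → F t x = 0

lemma test_lineDeriv_apply (φ : Test) (v x : Space) : (∂_{v} φ) x = fderiv ℝ φ x v := by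
  rw [TestFunction.lineDerivOp_eq_lineDerivCLM ℝ, TestFunction.lineDerivCLM_apply_of_le (by simp)]
  exact ((φ.contDiff.differentiable (by simp)) x).lineDeriv_eq_fderiv

lemma stTest_lineDeriv_apply (φ : STTest) (v : ℝ × Space) (t : ℝ) (x : Space) :
    (∂_{v} φ) (t, x) = pderiv v (fun t x => φ (t, x)) t x := by
  rw [TestFunction.lineDerivOp_eq_lineDerivCLM ℝ, TestFunction.lineDerivCLM_apply_of_le (by simp)]
  exact ((φ.contDiff.differentiable (by simp)) (t, x)).lineDeriv_eq_fderiv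

lemma exists_norm_bound_of_hasCompactSupport {E : Type*} [NormedAddCommGroup E] {f : E → ℝ}
    (hf : HasCompactSupport f) : ∃ R : ℝ, ∀ x, R < ‖x‖ → f x = 0 := by
  obtain ⟨R, hR⟩ := hf.isCompact.isBounded.exists_norm_le
  refine ⟨R, fun x hx => ?_⟩
  by_contra h
  exact absurd (hR x (subset_tsupport f h)) (not_le.2 hx)

lemma STTest.isTestCurve (φ : STTest) : IsTestCurve fun t x => φ (t, x) where
  smooth := φ.contDiff
  bounded T := by
    obtain ⟨R, hR⟩ := exists_norm_bound_of_hasCompactSupport φ.hasCompactSupport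
    exact ⟨R, fun t x _ hx => hR _ (hx.trans_le (by simp [Prod.norm_def]))⟩

lemma Test.isTestCurve (φ : Test) : IsTestCurve fun _ x => φ x where
  smooth := φ.contDiff.comp contDiff_snd
  bounded T := by
    obtain ⟨R, hR⟩ := exists_norm_bound_of_hasCompactSupport φ.hasCompactSupport
    exact ⟨R, fun t x _ hx => hR _ hx⟩

namespace IsTestCurve

variable {F G : ℝ → Space → ℝ}

lemma differentiableAt (hF : IsTestCurve F) (p : ℝ × Space) :
    DifferentiableAt ℝ (fun p : ℝ × Space => F p.1 p.2) p :=
  hF.smooth.differentiable (by simp) p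

lemma hasDerivAt_time (hF : IsTestCurve F) (t : ℝ) (x : Space) :
    HasDerivAt (fun s => F s x) (pderiv timeDir F t x) t := by
  have h : HasDerivAt (fun s : ℝ => (s, x)) (1, 0) t :=
    (hasDerivAt_id t).prodMk (hasDerivAt_const t x)
  exact HasFDerivAt.comp_hasDerivAt (l := fun p : ℝ × Space => F p.1 p.2) t
    (hF.differentiableAt (t, x)).hasFDerivAt h

lemma pderiv_space (hF : IsTestCurve F) (v : Space) (t : ℝ) (x : Space) :
    pderiv (0, v) F t x = fderiv ℝ (F t) x v := by
  have h := (hF.differentiableAt (t, x)).hasFDerivAt.comp x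
    ((hasFDerivAt_const t x).prodMk (hasFDerivAt_id x))
  have := h.fderiv
  change fderiv ℝ (F t) x = _ at this
  rw [this]
  simp [pderiv]

lemma smooth_slice (hF : IsTestCurve F) (t : ℝ) : ContDiff ℝ ∞ (F t) :=
  hF.smooth.comp (contDiff_const.prodMk contDiff_id)

lemma hasCompactSupport_slice (hF : IsTestCurve F) (t : ℝ) : HasCompactSupport (F t) := by
  obtain ⟨R, hR⟩ := hF.bounded |t|
  refine HasCompactSupport.intro (isCompact_closedBall (0 : Space) R) fun x hx => hR t x le_rfl ?_
  simpa using hx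

protected lemma pderiv (hF : IsTestCurve F) (v : ℝ × Space) : IsTestCurve (pderiv v F) where
  smooth := (hF.smooth.fderiv_right (m := ∞) (by simp)).clm_apply contDiff_const
  bounded T := by
    -- The extra time 1 makes `F` vanish on a whole neighbourhood of `(t, x)`, including at the
    -- endpoints `|t| = T`.
    obtain ⟨R, hR⟩ := hF.bounded (T + 1)
    refine ⟨R, fun t x ht hx => ?_⟩
    have h : (fun p : ℝ × Space => F p.1 p.2) =ᶠ[nhds (t, x)] fun _ => 0 := by
      have h1 : IsOpen {p : ℝ × Space | |p.1| < T + 1 ∧ R < ‖p.2‖} :=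
        (isOpen_lt (f := fun p : ℝ × Space => |p.1|) (by fun_prop) continuous_const).inter
          (isOpen_lt (g := fun p : ℝ × Space => ‖p.2‖) continuous_const (by fun_prop))
      filter_upwards [h1.mem_nhds (show (t, x) ∈ _ from ⟨by simp only; linarith, hx⟩)] with p hp
      exact hR _ _ hp.1.le hp.2
    simp [pderiv, h.fderiv_eq]

lemma pderiv_comm (hF : IsTestCurve F) (v w : ℝ × Space) :
    pderiv v (pderiv w F) = pderiv w (pderiv v F) := by
  funext t x
  have hs : IsSymmSndFDerivAt ℝ (fun p : ℝ × Space => F p.1 p.2) (t, x) :=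
    hF.smooth.contDiffAt.isSymmSndFDerivAt (by simpa using ENat.LEInfty.out)
  have hd : DifferentiableAt ℝ (fderiv ℝ fun p : ℝ × Space => F p.1 p.2) (t, x) :=
    (hF.smooth.fderiv_right (m := ∞) (by simp)).differentiable (by simp) _
  have key (v w : ℝ × Space) : pderiv v (pderiv w F) t x
      = fderiv ℝ (fderiv ℝ fun p : ℝ × Space => F p.1 p.2) (t, x) v w := by
    unfold pderiv
    simp only [Prod.mk.eta]
    rw [fderiv_clm_apply hd (differentiableAt_const _)]
    simp
  rw [key, key, hs.eq]

protected lemma add (hF : IsTestCurve F) (hG : IsTestCurve G) :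
    IsTestCurve fun t x => F t x + G t x where
  smooth := hF.smooth.add hG.smooth
  bounded T := by
    obtain ⟨R, hR⟩ := hF.bounded T
    obtain ⟨R', hR'⟩ := hG.bounded T
    exact ⟨max R R', fun t x ht hx => by
      rw [hR t x ht ((le_max_left _ _).trans_lt hx), hR' t x ht ((le_max_right _ _).trans_lt hx),
        add_zero]⟩

/-- Products with smooth functions of time. -/
protected lemma mul_left (hF : IsTestCurve F) {η : ℝ → ℝ} (hη : ContDiff ℝ ∞ η) :
    IsTestCurve fun t x => η t * F t x where
  smooth := (hη.comp contDiff_fst).mul hF.smooth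
  bounded T := by
    obtain ⟨R, hR⟩ := hF.bounded T
    exact ⟨R, fun t x ht hx => by rw [hR t x ht hx, mul_zero]⟩

protected lemma const_mul (hF : IsTestCurve F) (a : ℝ) : IsTestCurve fun t x => a * F t x :=
  hF.mul_left contDiff_const

protected lemma zero : IsTestCurve fun _ _ => 0 := ⟨contDiff_const, fun _ => ⟨0, by simp⟩⟩

protected lemma sum {κ : Type*} (s : Finset κ) {F : κ → ℝ → Space → ℝ}
    (hF : ∀ k ∈ s, IsTestCurve (F k)) : IsTestCurve fun t x => ∑ k ∈ s, F k t x := by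
  classical
  induction s using Finset.induction_on with
  | empty => simpa using IsTestCurve.zero
  | insert a s ha ih =>
    simp only [Finset.sum_insert ha]
    exact (hF a (by simp)).add (ih fun k hk => hF k (by simp [hk]))

/-- Affine changes of time. -/
protected lemma comp_affine (hF : IsTestCurve F) (a b : ℝ) : IsTestCurve fun t => F (a * t + b) where
  smooth := hF.smooth.comp
    (((contDiff_const.mul contDiff_fst).add contDiff_const).prodMk contDiff_snd)
  bounded T := by
    obtain ⟨R, hR⟩ := hF.bounded (|a| * T + |b|)
    refine ⟨R, fun t x ht hx => hR _ _ ?_ hx⟩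
    refine (abs_add_le _ _).trans ?_
    rw [abs_mul]
    gcongr

/-- A smooth function of compact support in time times a test curve, as a test function on
space-time. -/
def toSTTest (hF : IsTestCurve F) {η : ℝ → ℝ} (hη : ContDiff ℝ ∞ η) (hη' : HasCompactSupport η) :
    STTest where
  toFun p := η p.1 * F p.1 p.2
  contDiff' := (hF.mul_left hη).smooth
  hasCompactSupport' := by
    obtain ⟨T, hT⟩ := exists_norm_bound_of_hasCompactSupport hη'
    obtain ⟨R, hR⟩ := hF.bounded T
    refine HasCompactSupport.intro
      ((isCompact_closedBall (0 : ℝ) T).prod (isCompact_closedBall (0 : Space) R)) fun p hp => ?_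
    simp only [Set.mem_prod, mem_closedBall_zero_iff, not_and_or, not_le] at hp
    by_cases h : T < ‖p.1‖
    · rw [hT _ h, zero_mul]
    · rw [hR p.1 p.2 (not_lt.1 h) (hp.resolve_left h), mul_zero]
  tsupport_subset' := fun _ _ => trivial

/-- The test function on space given by a test curve at a fixed time. -/
def slice (hF : IsTestCurve F) (t : ℝ) : Test where
  toFun := F t
  contDiff' := hF.smooth_slice t
  hasCompactSupport' := hF.hasCompactSupport_slice t
  tsupport_subset' := fun _ _ => trivial

end IsTestCurve

end

/-! ### The Kirchhoff solution of the wave equation -/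

/-- The solution of the wave equation with initial data `0` and `ψ`. -/
def kirchhoff (ψ : Test) (t : ℝ) (x : Space) : ℝ :=
  t / (4 * Real.pi) * ∫ y, ψ (x + t • y) ∂sphereMeasure

lemma smooth_comp_add_smul (ψ : Test) : ContDiff ℝ ∞
    fun q : (ℝ × Space) × Space => ψ (q.1.2 + q.1.1 • q.2) :=
  ψ.contDiff.comp (contDiff_fst.snd.add (contDiff_fst.fst.smul contDiff_snd))

/-- Finite propagation speed: if `ψ` vanishes outside the ball of radius `R`, the sphere of radius
`|t|` around `x` meets only zeros of `ψ` once `‖x‖ > R + |t|`. -/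
lemma kirchhoff_isTestCurve (ψ : Test) : IsTestCurve (kirchhoff ψ) where
  smooth := (contDiff_fst.div_const _).mul
    (contDiff_integral_sphereMeasure (smooth_comp_add_smul ψ))
  bounded T := by
    obtain ⟨R, hR⟩ := exists_norm_bound_of_hasCompactSupport ψ.hasCompactSupport
    refine ⟨R + T, fun t x ht hx => ?_⟩
    have : ∫ y, ψ (x + t • y) ∂sphereMeasure = 0 := by
      refine integral_eq_zero_of_ae ?_
      filter_upwards [ae_norm_eq_one] with y hy
      refine hR _ ?_
      have := norm_sub_le (x + t • y) (t • y)
      rw [add_sub_cancel_right, norm_smul, hy, mul_one, Real.norm_eq_abs] at this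
      linarith
    simp [kirchhoff, this]

lemma hasDerivAt_test_line (ψ : Test) (x v : Space) (t : ℝ) :
    HasDerivAt (fun s : ℝ => ψ (x + s • v)) (fderiv ℝ ψ (x + t • v) v) t := by
  have h : HasDerivAt (fun s : ℝ => x + s • v) v t := by
    simpa using ((hasDerivAt_id t).smul_const v).const_add x
  exact HasFDerivAt.comp_hasDerivAt (l := ψ) t
    (ψ.contDiff.differentiable (by simp) _).hasFDerivAt h

lemma fderiv_test_eq_sum (ψ : Test) (x v : Space) :
    fderiv ℝ ψ x v = ∑ i, v i * (∂_{e i} ψ) x := by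
  have hv : v = ∑ i, v i • e i := by
    ext k; simp [Finset.sum_apply, Pi.single_apply]
  conv_lhs => rw [hv]
  simp [test_lineDeriv_apply]

lemma continuous_comp_add_smul (ψ : Test) (t : ℝ) (x : Space) :
    Continuous fun y => ψ (x + t • y) := ψ.continuous.comp (by fun_prop)

lemma hasDerivAt_sphereMean (ψ : Test) (x : Space) (t : ℝ) :
    HasDerivAt (fun s => ∫ y, ψ (x + s • y) ∂sphereMeasure)
      (∑ i, ∫ y, y i * (∂_{e i} ψ) (x + t • y) ∂sphereMeasure) t := by
  have hc (i : Fin 3) : Continuous fun p : ℝ × Space => p.2 i * (∂_{e i} ψ) (x + p.1 • p.2) :=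
    (by fun_prop : Continuous fun p : ℝ × Space => p.2 i).mul
      ((∂_{e i} ψ).continuous.comp (by fun_prop))
  have h := hasDerivAt_integral_sphereMeasure (h := fun s y => ψ (x + s • y))
    (h' := fun s y => ∑ i, y i * (∂_{e i} ψ) (x + s • y))
    (fun s y => by rw [← fderiv_test_eq_sum]; exact hasDerivAt_test_line ψ x y s)
    (fun s => continuous_comp_add_smul ψ s x) (continuous_finsetSum _ fun i _ => hc i) t
  have hi (i : Fin 3) : Integrable (fun y => y i * (∂_{e i} ψ) (x + t • y)) sphereMeasure :=
    integrable_sphereMeasure ((hc i).comp (Continuous.prodMk_right t))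
  rwa [integral_finsetSum _ fun i _ => hi i] at h

lemma pderiv_time_kirchhoff (ψ : Test) (t : ℝ) (x : Space) :
    pderiv timeDir (kirchhoff ψ) t x = 1 / (4 * Real.pi) * ∫ y, ψ (x + t • y) ∂sphereMeasure
      + t / (4 * Real.pi) * ∑ i, ∫ y, y i * (∂_{e i} ψ) (x + t • y) ∂sphereMeasure :=
  ((kirchhoff_isTestCurve ψ).hasDerivAt_time t x).unique
    (((hasDerivAt_id t).div_const (4 * Real.pi)).mul (hasDerivAt_sphereMean ψ x t))

/-- Spherical means commute with translations, so a spatial derivative falls on `ψ`. -/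
lemma pderiv_space_kirchhoff (ψ : Test) (i : Fin 3) :
    pderiv (spaceDir i) (kirchhoff ψ) = kirchhoff (∂_{e i} ψ) := by
  funext t x
  have hF := kirchhoff_isTestCurve ψ
  have h1 : HasDerivAt (fun s : ℝ => kirchhoff ψ t (x + s • e i))
      (pderiv (spaceDir i) (kirchhoff ψ) t x) 0 := by
    have h : HasDerivAt (fun s : ℝ => x + s • e i) (e i) 0 := by
      simpa using ((hasDerivAt_id (0 : ℝ)).smul_const (e i)).const_add x
    rw [hF.pderiv_space]
    refine HasFDerivAt.comp_hasDerivAt (l := kirchhoff ψ t) 0 ?_ h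
    simpa using (((hF.smooth_slice t).differentiable (by simp)) x).hasFDerivAt
  have h2 : HasDerivAt (fun s : ℝ => kirchhoff ψ t (x + s • e i))
      (kirchhoff (∂_{e i} ψ) t x) 0 := by
    unfold kirchhoff
    refine HasDerivAt.const_mul _ ?_
    have := hasDerivAt_integral_sphereMeasure (h := fun s y => ψ (x + s • e i + t • y))
      (h' := fun s y => (∂_{e i} ψ) (x + s • e i + t • y))
      (fun s y => by
        rw [test_lineDeriv_apply]
        have := hasDerivAt_test_line ψ (x + t • y) (e i) s
        simpa only [add_right_comm] using this)
      (fun s => continuous_comp_add_smul ψ t _)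
      ((∂_{e i} ψ).continuous.comp (by fun_prop)) 0
    simpa using this
  exact h1.unique h2

lemma test_lineDeriv_comm (ψ : Test) (v w : Space) : ∂_{v} (∂_{w} ψ) = ∂_{w} (∂_{v} ψ) := by
  have h := (Test.isTestCurve ψ).pderiv_comm (0, v) (0, w)
  have key (v w x : Space) : (∂_{v} (∂_{w} ψ)) x
      = pderiv (0, v) (pderiv (0, w) fun _ x => ψ x) 0 x := by
    have h1 : (pderiv (0, w) fun _ x => ψ x) = fun _ x => (∂_{w} ψ) x := by
      funext t x
      rw [(Test.isTestCurve ψ).pderiv_space, test_lineDeriv_apply]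
    rw [h1, (Test.isTestCurve _).pderiv_space, test_lineDeriv_apply]
  ext x
  rw [key, key, h]

/-- The second moments over the sphere of radius `t` around `x`. -/
def sphereMoment (i j : Fin 3) (ψ : Test) (t : ℝ) (x : Space) : ℝ :=
  ∫ y, y i * y j * ψ (x + t • y) ∂sphereMeasure

lemma sphereMoment_comm (i j : Fin 3) (ψ : Test) (t : ℝ) (x : Space) :
    sphereMoment i j ψ t x = sphereMoment j i ψ t x := by
  simp only [sphereMoment, mul_comm (_ : ℝ)]

lemma integrable_sphereMoment (i j : Fin 3) (ψ : Test) (t : ℝ) (x : Space) :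
    Integrable (fun y => y i * y j * ψ (x + t • y)) sphereMeasure :=
  integrable_sphereMeasure ((by fun_prop : Continuous fun y : Space => y i * y j).mul
    (continuous_comp_add_smul ψ t x))

lemma integrable_sphereMoment_one (i : Fin 3) (ψ : Test) (t : ℝ) (x : Space) :
    Integrable (fun y => y i * ψ (x + t • y)) sphereMeasure :=
  integrable_sphereMeasure ((by fun_prop : Continuous fun y : Space => y i).mul
    (continuous_comp_add_smul ψ t x))

/-- The rotational field `yᵢ∂ⱼ - yⱼ∂ᵢ` is applied to `yᵢ ∂ⱼψ(x + ty) - yⱼ ∂ᵢψ(x + ty)`. The chain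
rule produces `t` times second moments, the coefficients produce the first moments. Not dividing by
`t` keeps `t = 0` included. -/
lemma integral_rotational_sq (ψ : Test) (t : ℝ) (x : Space) (i j : Fin 3) (hij : i ≠ j) :
    t * (sphereMoment i i (∂_{e j} (∂_{e j} ψ)) t x + sphereMoment j j (∂_{e i} (∂_{e i} ψ)) t x
        - 2 * sphereMoment i j (∂_{e i} (∂_{e j} ψ)) t x)
      - ∫ y, y i * (∂_{e i} ψ) (x + t • y) ∂sphereMeasure
      - ∫ y, y j * (∂_{e j} ψ) (x + t • y) ∂sphereMeasure = 0 := by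
  have hd (χ : Test) (y : Space) : HasFDerivAt (fun y => χ (x + t • y))
      (t • fderiv ℝ χ (x + t • y)) y := by
    have h : HasFDerivAt (fun y : Space => x + t • y) (t • ContinuousLinearMap.id ℝ Space) y :=
      ((hasFDerivAt_id y).const_smul t).const_add x
    have := HasFDerivAt.comp (g := χ) y ((χ.contDiff.differentiable (by simp)) _).hasFDerivAt h
    have h2 : t • fderiv ℝ χ (x + t • y)
        = (fderiv ℝ χ (x + t • y)).comp (t • ContinuousLinearMap.id ℝ Space) := by
      ext v; simp
    rw [h2]; exact this
  have hp (k : Fin 3) (y : Space) : HasFDerivAt (fun y : Space => y k)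
      (EuclideanSpace.proj k : Space →L[ℝ] ℝ) y :=
    (EuclideanSpace.proj k : Space →L[ℝ] ℝ).hasFDerivAt
  have hsm (χ : Test) : ContDiff ℝ 1 fun y : Space => χ (x + t • y) :=
    (χ.contDiff.of_le (by simp)).comp (contDiff_const.add (contDiff_id.const_smul t))
  have hpr (k : Fin 3) : ContDiff ℝ 1 fun y : Space => y k :=
    (EuclideanSpace.proj k : Space →L[ℝ] ℝ).contDiff
  have h := integral_rotational_deriv i j hij
    (f := fun y => y i * (∂_{e j} ψ) (x + t • y) - y j * (∂_{e i} ψ) (x + t • y))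
    (((hpr i).mul (hsm _)).sub ((hpr j).mul (hsm _)))
  have hpt (y : Space) : fderiv ℝ
      (fun y => y i * (∂_{e j} ψ) (x + t • y) - y j * (∂_{e i} ψ) (x + t • y)) y
        (y i • e j - y j • e i) =
      t * (y i * y i * (∂_{e j} (∂_{e j} ψ)) (x + t • y)
        + y j * y j * (∂_{e i} (∂_{e i} ψ)) (x + t • y)
        - 2 * (y i * y j * (∂_{e i} (∂_{e j} ψ)) (x + t • y)))
        - y i * (∂_{e i} ψ) (x + t • y) - y j * (∂_{e j} ψ) (x + t • y) := by
    rw [(((hp i y).fun_mul (hd (∂_{e j} ψ) y)).fun_sub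
      ((hp j y).fun_mul (hd (∂_{e i} ψ) y))).fderiv]
    have hji : e j i = 0 := by simp [hij]
    have hij' : e i j = 0 := by simp [hij.symm]
    have hii (k : Fin 3) : e k k = 1 := by simp
    have hproj (k : Fin 3) (v : Space) : (EuclideanSpace.proj k : Space →L[ℝ] ℝ) v = v k := rfl
    simp only [sub_apply, add_apply, smul_apply, map_sub, map_smul, smul_eq_mul, ← test_lineDeriv_apply,
      hproj, hji, hij', hii, test_lineDeriv_comm ψ (e j) (e i)]
    ring
  have i1 := integrable_sphereMoment i i (∂_{e j} (∂_{e j} ψ)) t x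
  have i2 := integrable_sphereMoment j j (∂_{e i} (∂_{e i} ψ)) t x
  have i3 := (integrable_sphereMoment i j (∂_{e i} (∂_{e j} ψ)) t x).const_mul 2
  have i4 := integrable_sphereMoment_one i (∂_{e i} ψ) t x
  have i5 := integrable_sphereMoment_one j (∂_{e j} ψ) t x
  simp only [hpt] at h
  have i12 := i1.add i2
  have i123 := (i12.sub i3).const_mul t
  rw [integral_sub, integral_sub, integral_const_mul, integral_sub, integral_add i1 i2,
    integral_const_mul] at h
  · exact h
  exacts [i12, i3, i123, i4, i123.sub i4, i5]

lemma hasDerivAt_sphereMoment_one (i : Fin 3) (ψ : Test) (x : Space) (t : ℝ) :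
    HasDerivAt (fun s => ∫ y, y i * ψ (x + s • y) ∂sphereMeasure)
      (∑ j, sphereMoment i j (∂_{e j} ψ) t x) t := by
  have hc (j : Fin 3) : Continuous fun p : ℝ × Space => p.2 i * p.2 j * (∂_{e j} ψ) (x + p.1 • p.2) :=
    (by fun_prop : Continuous fun p : ℝ × Space => p.2 i * p.2 j).mul
      ((∂_{e j} ψ).continuous.comp (by fun_prop))
  have h := hasDerivAt_integral_sphereMeasure (h := fun s y => y i * ψ (x + s • y))
    (h' := fun s y => ∑ j, y i * y j * (∂_{e j} ψ) (x + s • y))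
    (fun s y => by
      have := (hasDerivAt_test_line ψ x y s).const_mul (y i)
      rw [fderiv_test_eq_sum, Finset.mul_sum] at this
      simpa only [mul_assoc] using this)
    (fun s => (by fun_prop : Continuous fun y : Space => y i).mul (continuous_comp_add_smul ψ s x))
    (continuous_finsetSum _ fun j _ => hc j) t
  rwa [integral_finsetSum _ fun j _ => integrable_sphereMoment i j _ t x] at h

lemma sum_sphereMoment_diag (ψ : Test) (t : ℝ) (x : Space) :
    ∑ j, sphereMoment j j ψ t x = ∫ y, ψ (x + t • y) ∂sphereMeasure := by
  simp only [sphereMoment]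
  rw [← integral_finsetSum _ fun j _ => integrable_sphereMoment j j _ t x]
  refine integral_congr_ae ?_
  filter_upwards [ae_norm_eq_one] with y hy
  have h := EuclideanSpace.real_norm_sq_eq y
  rw [hy] at h
  rw [← Finset.sum_mul]
  simp only [← pow_two, ← h, one_pow, one_mul]

/-- The spherical means solve the wave equation. -/
lemma pderiv_time_time_kirchhoff (ψ : Test) :
    pderiv timeDir (pderiv timeDir (kirchhoff ψ)) =
      fun t x => ∑ i, kirchhoff (∂_{e i} (∂_{e i} ψ)) t x := by
  funext t x
  have h1 := ((kirchhoff_isTestCurve ψ).pderiv timeDir).hasDerivAt_time t x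
  simp only [pderiv_time_kirchhoff] at h1
  have h2 := ((hasDerivAt_sphereMean ψ x t).const_mul (1 / (4 * Real.pi))).add
    (((hasDerivAt_id t).div_const (4 * Real.pi)).mul
      (HasDerivAt.fun_sum fun i (_ : i ∈ Finset.univ) =>
        hasDerivAt_sphereMoment_one i (∂_{e i} ψ) x t))
  rw [h1.unique h2]
  have r01 := integral_rotational_sq ψ t x 0 1 (by decide)
  have r02 := integral_rotational_sq ψ t x 0 2 (by decide)
  have r12 := integral_rotational_sq ψ t x 1 2 (by decide)
  simp only [kirchhoff, ← sum_sphereMoment_diag, Fin.sum_univ_three, id]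
  rw [test_lineDeriv_comm ψ (e 1) (e 0), test_lineDeriv_comm ψ (e 2) (e 0),
    test_lineDeriv_comm ψ (e 2) (e 1), sphereMoment_comm 1 0, sphereMoment_comm 2 0,
    sphereMoment_comm 2 1]
  -- With m the spherical mean, the claim is `t m'' + 2 m' = t Δm`. Every index lies in two of the
  -- three pairs, so the sum of the rotational identities contains the first moments twice, which is
  -- the term `2 m'`.
  linear_combination (-1 / (4 * Real.pi)) * (r01 + r02 + r12)

lemma integral_sphereMeasure_neg (f : Space → ℝ) :
    ∫ y, f (-y) ∂sphereMeasure = ∫ y, f y ∂sphereMeasure :=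
  integral_sphereMeasure_comp (LinearIsometryEquiv.neg ℝ) f

/-- Antipodal symmetry of the sphere leaves only the sign of the prefactor `t`. The parities of K
and ∂ₜK later turn the adjoint flow at `-t` into kernels at `t`. -/
lemma kirchhoff_neg (ψ : Test) (t : ℝ) (x : Space) : kirchhoff ψ (-t) x = -kirchhoff ψ t x := by
  have := integral_sphereMeasure_neg fun y => ψ (x + t • y)
  simp only [smul_neg] at this
  simp only [kirchhoff, neg_smul, this]
  ring

lemma kirchhoff_zero (ψ : Test) (x : Space) : kirchhoff ψ 0 x = 0 := by
  simp [kirchhoff]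

lemma pderiv_time_kirchhoff_neg (ψ : Test) (t : ℝ) (x : Space) :
    pderiv timeDir (kirchhoff ψ) (-t) x = pderiv timeDir (kirchhoff ψ) t x := by
  have hF := kirchhoff_isTestCurve ψ
  have h1 := (hF.hasDerivAt_time (-t) x).scomp t (hasDerivAt_neg t)
  have h2 : (fun s => kirchhoff ψ s x) ∘ Neg.neg = fun s => -kirchhoff ψ s x :=
    funext fun s => kirchhoff_neg ψ s x
  rw [h2] at h1
  have := h1.unique (hF.hasDerivAt_time t x).neg
  simpa using this

lemma sphereMeasure_real_univ : sphereMeasure.real Set.univ = 4 * Real.pi := by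
  have h : sphereMeasure Set.univ = (volume : Measure Space).toSphere Set.univ := by
    rw [sphereMeasure, Measure.map_apply measurable_subtype_coe MeasurableSet.univ, Set.preimage_univ]
  rw [Measure.real, h, Measure.toSphere_apply_univ, EuclideanSpace.volume_ball_fin_three]
  have h3 : 0 ≤ Real.pi * 4 / 3 := by positivity
  simp [ENNReal.toReal_ofReal h3]
  ring

lemma pderiv_time_kirchhoff_zero (ψ : Test) (x : Space) :
    pderiv timeDir (kirchhoff ψ) 0 x = ψ x := by
  rw [pderiv_time_kirchhoff]
  simp only [zero_smul, add_zero, integral_const, sphereMeasure_real_univ, smul_eq_mul, zero_div,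
    zero_mul]
  field_simp

lemma kirchhoff_add (φ ψ : Test) (t : ℝ) (x : Space) :
    kirchhoff (φ + ψ) t x = kirchhoff φ t x + kirchhoff ψ t x := by
  simp only [kirchhoff, add_apply]
  rw [integral_add (integrable_sphereMeasure (continuous_comp_add_smul φ t x))
    (integrable_sphereMeasure (continuous_comp_add_smul ψ t x)), mul_add]

lemma kirchhoff_smul (a : ℝ) (ψ : Test) (t : ℝ) (x : Space) :
    kirchhoff (a • ψ) t x = a * kirchhoff ψ t x := by
  simp only [kirchhoff, smul_apply, smul_eq_mul]
  rw [integral_const_mul]; ring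

section

/-! ### Test curves in `L²` -/

open Classical in
/-- The class in `L²` of a square integrable function. -/
def toL2 (f : Space → ℝ) : L2 := if h : MemLp f 2 volume then h.toLp f else 0

lemma toL2_ae {f : Space → ℝ} (hf : MemLp f 2 volume) : toL2 f =ᵐ[volume] f := by
  rw [toL2, dif_pos hf]; exact hf.coeFn_toLp

lemma inner_toL2 (u : L2) {f : Space → ℝ} (hf : MemLp f 2 volume) :
    inner ℝ u (toL2 f) = ∫ x, u x * f x := by
  rw [L2.inner_def]
  refine integral_congr_ae ?_
  filter_upwards [toL2_ae hf] with x hx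
  simp [hx, mul_comm]

lemma inner_toL2_toL2 {f g : Space → ℝ} (hf : MemLp f 2 volume) (hg : MemLp g 2 volume) :
    inner ℝ (toL2 f) (toL2 g) = ∫ x, f x * g x := by
  rw [inner_toL2 _ hg]
  refine integral_congr_ae ?_
  filter_upwards [toL2_ae hf] with x hx
  rw [hx]

lemma toL2_add {f g : Space → ℝ} (hf : MemLp f 2 volume) (hg : MemLp g 2 volume) :
    toL2 (fun x => f x + g x) = toL2 f + toL2 g := by
  have h : MemLp (fun x => f x + g x) 2 volume := hf.add hg
  rw [toL2, dif_pos h, toL2, dif_pos hf, toL2, dif_pos hg]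
  exact MemLp.toLp_add hf hg

lemma toL2_const_mul {f : Space → ℝ} (hf : MemLp f 2 volume) (a : ℝ) :
    toL2 (fun x => a * f x) = a • toL2 f := by
  have h : MemLp (fun x => a * f x) 2 volume := hf.const_mul a
  rw [toL2, dif_pos h, toL2, dif_pos hf]
  exact MemLp.toLp_const_smul a hf

lemma toL2_zero : toL2 (fun _ => 0) = 0 := by
  simpa using toL2_const_mul (f := fun _ => (0 : ℝ)) MemLp.zero 0

lemma toL2_sum {κ : Type*} (s : Finset κ) {f : κ → Space → ℝ}
    (hf : ∀ k ∈ s, MemLp (f k) 2 volume) :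
    toL2 (fun x => ∑ k ∈ s, f k x) = ∑ k ∈ s, toL2 (f k) := by
  classical
  induction s using Finset.induction_on with
  | empty =>
    have h : MemLp (fun _ : Space => (0 : ℝ)) 2 volume := MemLp.zero
    simp only [Finset.sum_empty]
    rw [toL2, dif_pos h]
    exact MemLp.toLp_zero h
  | insert a s ha ih =>
    simp only [Finset.sum_insert ha]
    rw [toL2_add (hf a (by simp)) (memLp_finsetSum s fun k hk => hf k (by simp [hk])),
      ih fun k hk => hf k (by simp [hk])]

lemma memLp_test (φ : Test) : MemLp φ 2 volume :=
  φ.continuous.memLp_of_hasCompactSupport φ.hasCompactSupport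

/-- Functions bounded by `C` and supported in a ball have small `L²` norm. -/
lemma norm_toL2_le {f : Space → ℝ} (hf : MemLp f 2 volume) {R C : ℝ} (hC : 0 ≤ C)
    (h0 : ∀ x, R < ‖x‖ → f x = 0) (hb : ∀ x, ‖f x‖ ≤ C) :
    ‖toL2 f‖ ≤ Real.sqrt ((volume : Measure Space).real (Metric.closedBall 0 R)) * C := by
  have h1 : ‖toL2 f‖ ^ 2 ≤ (volume : Measure Space).real (Metric.closedBall 0 R) * C ^ 2 := by
    rw [← real_inner_self_eq_norm_sq, inner_toL2_toL2 hf hf]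
    have h2 : ∫ x, f x * f x = ∫ x in Metric.closedBall (0 : Space) R, f x * f x := by
      refine (setIntegral_eq_integral_of_forall_compl_eq_zero fun x hx => ?_).symm
      rw [h0 x (by simpa using hx), zero_mul]
    rw [h2]
    have h3 := norm_setIntegral_le_of_norm_le_const (μ := (volume : Measure Space))
      (s := Metric.closedBall (0 : Space) R) (f := fun x => f x * f x) (C := C ^ 2)
      measure_closedBall_lt_top (fun x _ => by
        rw [norm_mul, pow_two]
        exact mul_le_mul (hb x) (hb x) (norm_nonneg _) hC)
    rw [mul_comm]
    exact (le_abs_self _).trans h3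
  refine (pow_le_pow_iff_left₀ (norm_nonneg _) (by positivity) two_ne_zero).1 ?_
  rw [mul_pow, Real.sq_sqrt measureReal_nonneg]
  exact h1

namespace IsTestCurve

variable {F G : ℝ → Space → ℝ}

lemma memLp (hF : IsTestCurve F) (t : ℝ) : MemLp (F t) 2 volume :=
  memLp_test (hF.slice t)

/-- Uniform continuity of the time derivative on a compact set and the mean value inequality bound
the Taylor remainder uniformly in `x`. Near `t` all supports lie in one ball, so a uniform bound is
an L² bound. -/
lemma hasDerivAt_toL2 (hF : IsTestCurve F) (t : ℝ) :
    HasDerivAt (fun s => toL2 (F s)) (toL2 (pderiv timeDir F t)) t := by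
  have hF' := hF.pderiv timeDir
  obtain ⟨R, hR⟩ := hF.bounded (|t| + 1)
  obtain ⟨R', hR'⟩ := hF'.bounded (|t| + 1)
  set V := Real.sqrt ((volume : Measure Space).real (Metric.closedBall 0 (max R R'))) with hV
  have hV0 : 0 ≤ V := Real.sqrt_nonneg _
  rw [hasDerivAt_iff_isLittleO, Asymptotics.isLittleO_iff]
  intro ε hε
  have huc : ∀ δ > 0, ∃ r > 0, r ≤ 1 ∧ ∀ s x, |s - t| < r →
      ‖pderiv timeDir F s x - pderiv timeDir F t x‖ ≤ δ := by
    intro δ hδ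
    have hK : IsCompact (Metric.closedBall t 1 ×ˢ Metric.closedBall (0 : Space) R') :=
      (isCompact_closedBall _ _).prod (isCompact_closedBall _ _)
    have := hK.uniformContinuousOn_of_continuous
      hF'.smooth.continuous.continuousOn
    rw [Metric.uniformContinuousOn_iff] at this
    obtain ⟨r, hr, h⟩ := this δ hδ
    refine ⟨min r 1, by positivity, min_le_right _ _, fun s x hs => ?_⟩
    have hs1 : |s - t| < r := hs.trans_le (min_le_left _ _)
    have hs2 : |s - t| < 1 := hs.trans_le (min_le_right _ _)
    by_cases hx : ‖x‖ ≤ R'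
    · have := h (s, x) ⟨by simpa [Real.dist_eq] using hs2.le, by simpa using hx⟩
        (t, x) ⟨by simp, by simpa using hx⟩ (by simpa [Prod.dist_eq, Real.dist_eq, hr] using hs1)
      exact this.le
    · have habs : |s| ≤ |t| + 1 := by
        have := abs_sub_abs_le_abs_sub s t
        linarith
      rw [hR' s x habs (not_le.1 hx), hR' t x (by linarith) (not_le.1 hx)]
      simpa using hδ.le
  -- `V` is the factor between sup norm and L² norm on the common ball; `V + 1` keeps the
  -- denominator positive.
  obtain ⟨r, hr, hr1, h⟩ := huc (ε / (V + 1)) (by positivity)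
  filter_upwards [Metric.ball_mem_nhds t hr] with s hs
  rw [Metric.mem_ball, Real.dist_eq] at hs
  have habs : |s| ≤ |t| + 1 := by
    have := abs_sub_abs_le_abs_sub s t
    linarith
  have h23 : MemLp (fun x => (-1) * F t x + (-(s - t)) * pderiv timeDir F t x) 2 volume :=
    ((hF.memLp t).const_mul (-1)).add ((hF'.memLp t).const_mul _)
  have h123 : MemLp (fun x => F s x + ((-1) * F t x + (-(s - t)) * pderiv timeDir F t x)) 2
      volume := (hF.memLp s).add h23
  have heq : toL2 (F s) - toL2 (F t) - (s - t) • toL2 (pderiv timeDir F t)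
      = toL2 fun x => F s x + ((-1) * F t x + (-(s - t)) * pderiv timeDir F t x) := by
    rw [toL2_add (hF.memLp s) h23, toL2_add ((hF.memLp t).const_mul (-1))
      ((hF'.memLp t).const_mul _), toL2_const_mul (hF.memLp t), toL2_const_mul (hF'.memLp t)]
    module
  rw [heq]
  have hb (x : Space) : ‖F s x + ((-1) * F t x + (-(s - t)) * pderiv timeDir F t x)‖
      ≤ ε / (V + 1) * ‖s - t‖ := by
    have h1 : ∀ τ ∈ Metric.ball t r, HasDerivWithinAt
        (fun τ => F τ x - (τ - t) * pderiv timeDir F t x)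
        (pderiv timeDir F τ x - 1 * pderiv timeDir F t x) (Metric.ball t r) τ := fun τ _ =>
      ((hF.hasDerivAt_time τ x).sub
        (((hasDerivAt_id τ).sub_const t).mul_const _)).hasDerivWithinAt
    have := (convex_ball t r).norm_image_sub_le_of_norm_hasDerivWithin_le h1
      (fun τ hτ => by
        rw [one_mul]
        exact h τ x (by simpa [Real.dist_eq] using hτ)) (Metric.mem_ball_self hr)
      (show s ∈ Metric.ball t r by simpa [Real.dist_eq] using hs)
    have h2 : F s x + ((-1) * F t x + (-(s - t)) * pderiv timeDir F t x)
        = F s x - (s - t) * pderiv timeDir F t x - (F t x - (t - t) * pderiv timeDir F t x) := by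
      ring
    rw [h2]
    exact this
  refine (norm_toL2_le h123 (R := max R R') (by positivity) (fun x hx => ?_) hb).trans ?_
  · rw [hR s x habs ((le_max_left _ _).trans_lt hx), hR t x (by linarith)
      ((le_max_left _ _).trans_lt hx), hR' t x (by linarith) ((le_max_right _ _).trans_lt hx)]
    simp
  · rw [← hV, ← mul_assoc]
    refine mul_le_mul_of_nonneg_right ?_ (norm_nonneg _)
    rw [mul_div_assoc', div_le_iff₀ (by positivity)]
    nlinarith

lemma continuous_toL2 (hF : IsTestCurve F) : Continuous fun t => toL2 (F t) :=
  continuous_iff_continuousAt.2 fun t => (hF.hasDerivAt_toL2 t).continuousAt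

end IsTestCurve

/-- Integration by parts. -/
lemma inner_toL2_lineDeriv (φ ψ : Test) (v : Space) :
    inner ℝ (toL2 φ) (toL2 (∂_{v} ψ : Test)) = -inner ℝ (toL2 (∂_{v} φ : Test)) (toL2 ψ) := by
  rw [inner_toL2_toL2 (memLp_test _) (memLp_test _), inner_toL2_toL2 (memLp_test _) (memLp_test _)]
  simp only [test_lineDeriv_apply]
  have hint (φ ψ : Test) : Integrable (fun x => φ x * ψ x) volume :=
    (φ.continuous.mul ψ.continuous).integrable_of_hasCompactSupport
      (φ.hasCompactSupport.mul_right)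
  refine integral_mul_fderiv_eq_neg_fderiv_mul_of_integrable ?_ ?_ (hint φ ψ)
    (fun x _ => φ.contDiff.differentiable (by simp) x)
    (fun x _ => ψ.contDiff.differentiable (by simp) x)
  · simpa only [test_lineDeriv_apply] using hint (∂_{v} φ) ψ
  · simpa only [test_lineDeriv_apply] using hint φ (∂_{v} ψ)

lemma eq_zero_of_inner_test_eq_zero {u : L2} (h : ∀ φ : Test, inner ℝ u (toL2 φ) = 0) : u = 0 := by
  rw [Lp.eq_zero_iff_ae_eq_zero]
  refine ae_eq_zero_of_integral_contDiff_smul_eq_zero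
    ((Lp.memLp u).locallyIntegrable (by norm_num)) fun g hg hg' => ?_
  have := h ⟨g, hg, hg', fun _ _ => trivial⟩
  rw [inner_toL2 _ (memLp_test _)] at this
  rw [← this]
  refine integral_congr_ae (Filter.Eventually.of_forall fun x => ?_)
  exact mul_comm _ _

end

section

/-! ### Symmetric first order systems whose square is the wave equation -/

/-! ### Rules for derivatives of test curves -/

section calculus

variable {F G : ℝ → Space → ℝ}

lemma pderiv_add (hF : IsTestCurve F) (hG : IsTestCurve G) (v : ℝ × Space) (t : ℝ) (x : Space) :
    pderiv v (fun t x => F t x + G t x) t x = pderiv v F t x + pderiv v G t x := by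
  simp only [pderiv]
  rw [fderiv_fun_add (hF.differentiableAt _) (hG.differentiableAt _)]
  rfl

lemma pderiv_const_mul (hF : IsTestCurve F) (a : ℝ) (v : ℝ × Space) (t : ℝ) (x : Space) :
    pderiv v (fun t x => a * F t x) t x = a * pderiv v F t x := by
  simp only [pderiv]
  rw [fderiv_const_mul (hF.differentiableAt _)]
  rfl

lemma pderiv_sum {κ : Type*} (s : Finset κ) {F : κ → ℝ → Space → ℝ}
    (hF : ∀ k, IsTestCurve (F k)) (v : ℝ × Space) (t : ℝ) (x : Space) :
    pderiv v (fun t x => ∑ k ∈ s, F k t x) t x = ∑ k ∈ s, pderiv v (F k) t x := by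
  simp only [pderiv]
  rw [fderiv_fun_sum fun k _ => (hF k).differentiableAt _]
  simp [sum_apply]

lemma IsTestCurve.comp_mul (hF : IsTestCurve F) (c : ℝ) : IsTestCurve fun t => F (c * t) := by
  simpa using hF.comp_affine c 0

lemma pderiv_space_comp_affine (hF : IsTestCurve F) (v : Space) (a b t : ℝ) (x : Space) :
    pderiv (0, v) (fun t => F (a * t + b)) t x = pderiv (0, v) F (a * t + b) x := by
  rw [(hF.comp_affine a b).pderiv_space, hF.pderiv_space]

lemma pderiv_time_comp_affine (hF : IsTestCurve F) (a b t : ℝ) (x : Space) :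
    pderiv timeDir (fun t => F (a * t + b)) t x = a * pderiv timeDir F (a * t + b) x := by
  refine ((hF.comp_affine a b).hasDerivAt_time t x).unique ?_
  have h : HasDerivAt (fun s : ℝ => a * s + b) a t := by
    simpa using ((hasDerivAt_id t).const_mul a).add_const b
  exact (hF.hasDerivAt_time (a * t + b) x).scomp t h

lemma pderiv_space_comp_mul (hF : IsTestCurve F) (v : Space) (c t : ℝ) (x : Space) :
    pderiv (0, v) (fun t => F (c * t)) t x = pderiv (0, v) F (c * t) x := by
  simpa using pderiv_space_comp_affine hF v c 0 t x

lemma pderiv_time_comp_mul (hF : IsTestCurve F) (c t : ℝ) (x : Space) :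
    pderiv timeDir (fun t => F (c * t)) t x = c * pderiv timeDir F (c * t) x := by
  simpa using pderiv_time_comp_affine hF c 0 t x

end calculus

variable {ι : Type} [Fintype ι]

/-- The operator `∑ Aᵢ ∂ᵢ`. -/
def dirac (A : Fin 3 → Matrix ι ι ℝ) (F : ι → ℝ → Space → ℝ) (k : ι) (t : ℝ) (x : Space) : ℝ :=
  ∑ i, ∑ l, A i k l * pderiv (spaceDir i) (F l) t x

/-- The classical solution of `∂ₜ F = c ∑ Aᵢ ∂ᵢ F` with the initial value `Φ`. -/
def flow (A : Fin 3 → Matrix ι ι ℝ) (c : ℝ) (Φ : ι → Test) (k : ι) (t : ℝ) (x : Space) : ℝ :=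
  pderiv timeDir (kirchhoff (Φ k)) (c * t) x
    + ∑ i, ∑ l, A i k l * kirchhoff (∂_{e i} (Φ l)) (c * t) x

variable {A : Fin 3 → Matrix ι ι ℝ}

lemma isTestCurve_dirac {F : ι → ℝ → Space → ℝ} (hF : ∀ k, IsTestCurve (F k)) (k : ι) :
    IsTestCurve (dirac A F k) :=
  IsTestCurve.sum _ fun _ _ => IsTestCurve.sum _ fun l _ => ((hF l).pderiv _).const_mul _

lemma isTestCurve_flow (c : ℝ) (Φ : ι → Test) (k : ι) : IsTestCurve (flow A c Φ k) :=
  (((kirchhoff_isTestCurve (Φ k)).pderiv timeDir).comp_mul c).add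
    (IsTestCurve.sum _ fun _ _ => IsTestCurve.sum _ fun _ _ =>
      ((kirchhoff_isTestCurve _).comp_mul c).const_mul _)

lemma flow_zero (c : ℝ) (Φ : ι → Test) (k : ι) : flow A c Φ k 0 = Φ k := by
  funext x
  simp [flow, kirchhoff_zero, pderiv_time_kirchhoff_zero]

lemma pderiv_flow (c : ℝ) (Φ : ι → Test) (v : ℝ × Space) (k : ι) (t : ℝ) (x : Space) :
    pderiv v (flow A c Φ k) t x =
      pderiv v (fun t => pderiv timeDir (kirchhoff (Φ k)) (c * t)) t x
        + ∑ i, ∑ l, A i k l * pderiv v (fun t => kirchhoff (∂_{e i} (Φ l)) (c * t)) t x := by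
  have h1 (i : Fin 3) (l : ι) := (kirchhoff_isTestCurve (∂_{e i} (Φ l))).comp_mul c
  have h2 (i : Fin 3) : IsTestCurve
      fun t x => ∑ l, A i k l * kirchhoff (∂_{e i} (Φ l)) (c * t) x :=
    IsTestCurve.sum _ fun l _ => (h1 i l).const_mul _
  have h3 : IsTestCurve
      fun t x => ∑ i, ∑ l, A i k l * kirchhoff (∂_{e i} (Φ l)) (c * t) x :=
    IsTestCurve.sum _ fun i _ => h2 i
  unfold flow
  rw [pderiv_add (((kirchhoff_isTestCurve (Φ k)).pderiv timeDir).comp_mul c) h3,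
    pderiv_sum _ h2]
  congr 1
  refine Finset.sum_congr rfl fun i _ => ?_
  rw [pderiv_sum _ fun l => (h1 i l).const_mul _]
  exact Finset.sum_congr rfl fun l _ => pderiv_const_mul (h1 i l) _ _ _ _

variable [DecidableEq ι]

/-- Symmetric matrices satisfying the Clifford relations. -/
structure IsClifford (A : Fin 3 → Matrix ι ι ℝ) : Prop where
  symm : ∀ i k l, A i k l = A i l k
  anticomm : ∀ i j, A i * A j + A j * A i = if i = j then 2 else 0

/-- Symmetry of `T` in `i, j` allows `Aᵢ Aⱼ` to be replaced by half the anticommutator. With `T i j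
m = ∂ᵢ∂ⱼ wₘ` this is the identity D² = Δ. -/
lemma IsClifford.sum_sum (hA : IsClifford A) (T : Fin 3 → Fin 3 → ι → ℝ)
    (hT : ∀ i j m, T i j m = T j i m) (k : ι) :
    ∑ i, ∑ l, A i k l * ∑ j, ∑ m, A j l m * T i j m = ∑ i, T i i k := by
  have h1 : ∑ i, ∑ l, A i k l * ∑ j, ∑ m, A j l m * T i j m
      = ∑ i, ∑ j, ∑ m, (A i * A j) k m * T i j m := by
    simp only [Matrix.mul_apply, Finset.mul_sum, Finset.sum_mul]
    refine Finset.sum_congr rfl fun i _ => ?_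
    rw [Finset.sum_comm]
    refine Finset.sum_congr rfl fun j _ => ?_
    rw [Finset.sum_comm]
    simp only [mul_assoc]
  have h2 : ∑ i, ∑ j, ∑ m, (A i * A j) k m * T i j m
      = ∑ i, ∑ j, ∑ m, (A j * A i) k m * T i j m := by
    rw [Finset.sum_comm]
    simp only [fun i j m => hT j i m]
  have h3 : ∑ i, ∑ j, ∑ m, (A i * A j + A j * A i) k m * T i j m = 2 * ∑ i, T i i k := by
    simp only [hA.anticomm]
    rw [Finset.mul_sum]
    refine Finset.sum_congr rfl fun i _ => ?_
    rw [Finset.sum_eq_single i (fun j _ hj => by simp [hj.symm]) (by simp)]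
    rw [Finset.sum_eq_single k (fun m _ hm => by
      simp [Matrix.ofNat_apply, hm.symm]) (by simp)]
    simp [Matrix.ofNat_apply]
  simp only [Matrix.add_apply, add_mul, Finset.sum_add_distrib] at h3
  rw [h1]
  linarith

/-- The flow is (∂ₜK + D K)(ct). Its time derivative is c(∂ₜ²K + D ∂ₜK)(ct), and ∂ₜ²K = ΔK = D(D K),
so this is cD applied to the flow. -/
lemma pderiv_time_flow (hA : IsClifford A) (c : ℝ) (Φ : ι → Test) (k : ι) :
    pderiv timeDir (flow A c Φ k) = fun t x => c * dirac A (flow A c Φ) k t x := by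
  funext t x
  have h1 (i : Fin 3) (l : ι) : pderiv (spaceDir i) (flow A c Φ l) t x
      = pderiv timeDir (kirchhoff (∂_{e i} (Φ l))) (c * t) x
        + ∑ j, ∑ m, A j l m * kirchhoff (∂_{e i} (∂_{e j} (Φ m))) (c * t) x := by
    rw [pderiv_flow, pderiv_space_comp_mul ((kirchhoff_isTestCurve _).pderiv _),
      (kirchhoff_isTestCurve _).pderiv_comm, pderiv_space_kirchhoff]
    simp only [pderiv_space_comp_mul (kirchhoff_isTestCurve _), pderiv_space_kirchhoff]
  have h2 := hA.sum_sum (fun i j m => kirchhoff (∂_{e i} (∂_{e j} (Φ m))) (c * t) x)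
    (fun i j m => by rw [test_lineDeriv_comm]) k
  rw [pderiv_flow]
  simp only [dirac, h1, pderiv_time_comp_mul (kirchhoff_isTestCurve _),
    pderiv_time_comp_mul ((kirchhoff_isTestCurve _).pderiv _), pderiv_time_time_kirchhoff, mul_add,
    Finset.sum_add_distrib, h2]
  simp only [Finset.mul_sum]
  rw [add_comm]
  congr 1
  exact Finset.sum_congr rfl fun i _ => Finset.sum_congr rfl fun l _ => by ring

end

section

variable {ι : Type} [Fintype ι]

/-! ### The unitary group -/

section extension

variable {X E : Type*} [AddCommGroup X] [Module ℝ X] [NormedAddCommGroup E] [InnerProductSpace ℝ E]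
  [CompleteSpace E]

/-- The continuous extension of a linear map `f`, isometric with respect to the dense map `g`. -/
def isometricExtension (f g : X →ₗ[ℝ] E) : E →L[ℝ] E := f.extendOfNorm g

lemma isometricExtension_apply {f g : X →ₗ[ℝ] E} (hg : DenseRange g) (h : ∀ x, ‖f x‖ = ‖g x‖)
    (x : X) : isometricExtension f g (g x) = f x :=
  LinearMap.extendOfNorm_eq hg ⟨1, fun x => by rw [h, one_mul]⟩ x

end extension

/-- Tuples of square integrable functions. -/
abbrev H (ι : Type) [Fintype ι] : Type := PiLp 2 fun _ : ι => L2

/-- The class in `L²` of a tuple of square integrable functions. -/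
def toH (f : ι → Space → ℝ) : H ι := WithLp.toLp 2 fun k => toL2 (f k)

lemma toH_apply (f : ι → Space → ℝ) (k : ι) : toH f k = toL2 (f k) := rfl

lemma inner_toH (u : H ι) (f : ι → Space → ℝ) :
    inner ℝ u (toH f) = ∑ k, inner ℝ (u k) (toL2 (f k)) := by
  rw [PiLp.inner_apply]; rfl

lemma hasDerivAt_toH {F : ι → ℝ → Space → ℝ} (hF : ∀ k, IsTestCurve (F k)) (t : ℝ) :
    HasDerivAt (fun s => toH fun k => F k s) (toH fun k => pderiv timeDir (F k) t) t := by
  have h : HasDerivAt (fun s (k : ι) => toL2 (F k s)) (fun k => toL2 (pderiv timeDir (F k) t)) t :=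
    hasDerivAt_pi.2 fun k => (hF k).hasDerivAt_toL2 t
  exact ((PiLp.continuousLinearEquiv 2 ℝ fun _ : ι => L2).symm :
    (ι → L2) →L[ℝ] H ι).hasFDerivAt.comp_hasDerivAt t h

lemma continuous_toH {F : ι → ℝ → Space → ℝ} (hF : ∀ k, IsTestCurve (F k)) :
    Continuous fun s => toH fun k => F k s :=
  continuous_iff_continuousAt.2 fun t => (hasDerivAt_toH hF t).continuousAt

lemma toH_const_mul {f : ι → Space → ℝ} (hf : ∀ k, MemLp (f k) 2 volume) (a : ℝ) :
    (toH fun k x => a * f k x) = a • toH f := by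
  ext1 k
  exact toL2_const_mul (hf k) a

/-- Tuples of test functions as square integrable functions. -/
def testH : (ι → Test) →ₗ[ℝ] H ι where
  toFun Φ := toH fun k => Φ k
  map_add' Φ Ψ := by
    ext1 k
    exact toL2_add (memLp_test (Φ k)) (memLp_test (Ψ k))
  map_smul' a Φ := by
    ext1 k
    exact toL2_const_mul (memLp_test (Φ k)) a

lemma testH_apply (Φ : ι → Test) : testH Φ = toH fun k => Φ k := rfl

lemma inner_testH_single [DecidableEq ι] (u : H ι) (k : ι) (φ : Test) :
    inner ℝ u (testH (Pi.single k φ)) = inner ℝ (u k) (toL2 φ) := by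
  rw [testH_apply, inner_toH, Finset.sum_eq_single k]
  · rw [Pi.single_eq_same]
  · intro l _ hl
    have h : ⇑((Pi.single k φ : ι → Test) l) = fun _ => (0 : ℝ) := by
      rw [Pi.single_eq_of_ne hl]; rfl
    rw [h, toL2_zero, inner_zero_right]
  · simp

lemma ext_inner_testH {u v : H ι} (h : ∀ Φ, inner ℝ u (testH Φ) = inner ℝ v (testH Φ)) :
    u = v := by
  classical
  rw [← sub_eq_zero]
  ext1 k
  refine eq_zero_of_inner_test_eq_zero fun φ => ?_
  have h1 : inner ℝ (u - v) (testH (Pi.single k φ)) = 0 := by rw [inner_sub_left, h, sub_self]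
  rwa [inner_testH_single] at h1

lemma denseRange_testH : DenseRange (testH : (ι → Test) →ₗ[ℝ] H ι) := by
  have h : (LinearMap.range (testH : (ι → Test) →ₗ[ℝ] H ι)).topologicalClosure = ⊤ := by
    rw [Submodule.topologicalClosure_eq_top_iff, Submodule.eq_bot_iff]
    intro v hv
    refine ext_inner_testH fun Φ => ?_
    rw [inner_zero_left, real_inner_comm]
    exact hv _ (LinearMap.mem_range_self _ _)
  have := Submodule.dense_iff_topologicalClosure_eq_top.2 h
  exact this

variable {A : Fin 3 → Matrix ι ι ℝ}

lemma toL2_dirac {F : ι → ℝ → Space → ℝ} (hF : ∀ k, IsTestCurve (F k)) (k : ι) (t : ℝ) :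
    toL2 (dirac A F k t) = ∑ i, ∑ l, A i k l • toL2 (pderiv (spaceDir i) (F l) t) := by
  unfold dirac
  rw [toL2_sum _ fun i _ => memLp_finsetSum _ fun l _ => (((hF l).pderiv _).memLp t).const_mul _]
  refine Finset.sum_congr rfl fun i _ => ?_
  rw [toL2_sum _ fun l _ => (((hF l).pderiv _).memLp t).const_mul _]
  exact Finset.sum_congr rfl fun l _ => toL2_const_mul (((hF l).pderiv _).memLp t) _

/-- Integration by parts changes the sign, and symmetry of the matrices lets them move to the other
factor: D is skew. -/
lemma inner_toH_dirac (hA : ∀ i k l, A i k l = A i l k) {F G : ι → ℝ → Space → ℝ}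
    (hF : ∀ k, IsTestCurve (F k)) (hG : ∀ k, IsTestCurve (G k)) (t : ℝ) :
    inner ℝ (toH fun k => F k t) (toH fun k => dirac A G k t)
      = -inner ℝ (toH fun k => dirac A F k t) (toH fun k => G k t) := by
  have hibp (i : Fin 3) (k l : ι) : inner ℝ (toL2 (F k t)) (toL2 (pderiv (spaceDir i) (G l) t))
      = -inner ℝ (toL2 (pderiv (spaceDir i) (F k) t)) (toL2 (G l t)) := by
    have hs {F : ℝ → Space → ℝ} (hF : IsTestCurve F) :
        pderiv (spaceDir i) F t = (∂_{e i} (hF.slice t) : Test) := by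
      funext x
      rw [hF.pderiv_space, test_lineDeriv_apply]; rfl
    rw [hs (hF k), hs (hG l)]
    exact inner_toL2_lineDeriv ((hF k).slice t) ((hG l).slice t) (e i)
  rw [inner_toH, inner_toH]
  simp only [toH_apply, toL2_dirac hF, toL2_dirac hG, inner_sum, sum_inner, inner_smul_left, inner_smul_right, hibp,
    RCLike.conj_to_real, mul_neg, Finset.sum_neg_distrib]
  congr 1
  rw [Finset.sum_comm]
  conv_rhs => rw [Finset.sum_comm]
  refine Finset.sum_congr rfl fun i _ => ?_
  rw [Finset.sum_comm]
  exact Finset.sum_congr rfl fun k _ => Finset.sum_congr rfl fun l _ => by rw [hA]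

/-- The solution operator on test functions. -/
def flowH (A : Fin 3 → Matrix ι ι ℝ) (c t : ℝ) : (ι → Test) →ₗ[ℝ] H ι where
  toFun Φ := toH fun k => flow A c Φ k t
  map_add' Φ Ψ := by
    ext1 k
    have hadd : flow A c (Φ + Ψ) k t = fun x => flow A c Φ k t x + flow A c Ψ k t x := by
      funext x
      have h1 : kirchhoff (Φ k + Ψ k) = fun t x => kirchhoff (Φ k) t x + kirchhoff (Ψ k) t x := by
        funext t x; exact kirchhoff_add _ _ t x
      simp only [flow, Pi.add_apply, h1, pderiv_add (kirchhoff_isTestCurve _) (kirchhoff_isTestCurve _),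
        LineDeriv.lineDerivOp_add, kirchhoff_add, mul_add, Finset.sum_add_distrib]
      ring
    exact (congrArg toL2 hadd).trans
      (toL2_add ((isTestCurve_flow c Φ k).memLp t) ((isTestCurve_flow c Ψ k).memLp t))
  map_smul' a Φ := by
    ext1 k
    have hsmul : flow A c (a • Φ) k t = fun x => a * flow A c Φ k t x := by
      funext x
      have h1 : kirchhoff (a • Φ k) = fun t x => a * kirchhoff (Φ k) t x := by
        funext t x; exact kirchhoff_smul _ _ t x
      simp only [flow, Pi.smul_apply, h1, pderiv_const_mul (kirchhoff_isTestCurve _),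
        LineDeriv.lineDerivOp_smul, kirchhoff_smul, mul_add, Finset.mul_sum]
      congr 1
      exact Finset.sum_congr rfl fun i _ => Finset.sum_congr rfl fun l _ => by ring
    exact (congrArg toL2 hsmul).trans (toL2_const_mul ((isTestCurve_flow c Φ k).memLp t) a)

lemma flowH_apply (c t : ℝ) (Φ : ι → Test) : flowH A c t Φ = toH fun k => flow A c Φ k t := rfl

variable [DecidableEq ι]

/-- The inner product of two solutions is conserved. -/
lemma inner_flow_flow (hA : IsClifford A) (c : ℝ) (Φ Ψ : ι → Test) (t s : ℝ) :
    inner ℝ (toH fun k => flow A c Φ k (t + s)) (toH fun k => flow A c Ψ k s)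
      = inner ℝ (toH fun k => flow A c Φ k t) (testH Ψ) := by
  have hF (k : ι) : IsTestCurve fun r => flow A c Φ k (1 * r + t) :=
    (isTestCurve_flow c Φ k).comp_affine 1 t
  have hG (k : ι) := isTestCurve_flow (A := A) c Ψ k
  -- The equation is autonomous, so the shifted curve solves it too; skewness of D then makes the
  -- inner product of two solutions constant.
  have h1 (r : ℝ) : HasDerivAt (fun r => inner ℝ (toH fun k => flow A c Φ k (1 * r + t))
      (toH fun k => flow A c Ψ k r)) 0 r := by
    have := (hasDerivAt_toH hF r).inner ℝ (hasDerivAt_toH hG r)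
    refine this.congr_deriv ?_
    have e1 : (fun k => pderiv timeDir (flow A c Ψ k) r)
        = fun k x => c * dirac A (flow A c Ψ) k r x := by
      simp only [pderiv_time_flow hA]
    have e2 : (fun k => pderiv timeDir (fun r => flow A c Φ k (1 * r + t)) r)
        = fun k x => c * dirac A (fun k r => flow A c Φ k (1 * r + t)) k r x := by
      funext k x
      rw [pderiv_time_comp_affine (isTestCurve_flow c Φ k), pderiv_time_flow hA, one_mul]
      simp only [dirac, pderiv_space_comp_affine (isTestCurve_flow c Φ _)]
    rw [e1, e2, toH_const_mul fun k => (isTestCurve_dirac hG k).memLp r,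
      toH_const_mul (f := fun k x => dirac A (fun k r => flow A c Φ k (1 * r + t)) k r x)
        fun k => (isTestCurve_dirac hF k).memLp r,
      inner_smul_left, inner_smul_right, inner_toH_dirac hA.symm hF hG]
    simp
  have h2 := is_const_of_deriv_eq_zero (fun r => (h1 r).differentiableAt)
    (fun r => (h1 r).deriv) s 0
  simp only [one_mul, zero_add, flow_zero] at h2
  rw [add_comm t s, h2]
  rfl

/-- The solution operator on `L²`. -/
@[irreducible]
def U (A : Fin 3 → Matrix ι ι ℝ) (c t : ℝ) : H ι →L[ℝ] H ι := isometricExtension (flowH A c t) testH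

lemma norm_flowH (hA : IsClifford A) (c t : ℝ) (Φ : ι → Test) : ‖flowH A c t Φ‖ = ‖testH Φ‖ := by
  have h := inner_flow_flow hA c Φ Φ 0 t
  simp only [zero_add, flow_zero] at h
  have h' : inner ℝ (flowH A c t Φ) (flowH A c t Φ) = inner ℝ (testH Φ) (testH Φ) := h
  rw [real_inner_self_eq_norm_sq, real_inner_self_eq_norm_sq] at h'
  exact (sq_eq_sq₀ (norm_nonneg _) (norm_nonneg _)).1 h'

lemma U_testH (hA : IsClifford A) (c t : ℝ) (Φ : ι → Test) :
    U A c t (testH Φ) = toH fun k => flow A c Φ k t := by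
  have h : U A c t (testH Φ) = flowH A c t Φ := by
    unfold U
    exact isometricExtension_apply (f := flowH A c t) denseRange_testH (norm_flowH hA c t) Φ
  rw [h, flowH_apply]

lemma U_zero (hA : IsClifford A) (c : ℝ) (u : H ι) : U A c 0 u = u := by
  refine denseRange_testH.induction_on u (isClosed_eq (U A c 0).continuous continuous_id) fun Φ => ?_
  rw [U_testH hA]
  simp only [flow_zero]
  rfl

/-- The density extension of `inner_flow_flow`. This one identity contains the isometry (`t = 0`),
the adjoint relation (`t + s = 0`) and, through the latter, the group law. -/
lemma inner_U_U (hA : IsClifford A) (c t s : ℝ) (u v : H ι) :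
    inner ℝ (U A c (t + s) u) (U A c s v) = inner ℝ (U A c t u) v := by
  refine denseRange_testH.induction_on₂ (p := fun u v =>
    inner ℝ (U A c (t + s) u) (U A c s v) = inner ℝ (U A c t u) v)
    (isClosed_eq (by fun_prop) (by fun_prop)) (fun Φ Ψ => ?_) u v
  rw [U_testH hA, U_testH hA, U_testH hA, inner_flow_flow hA]

lemma norm_U (hA : IsClifford A) (c t : ℝ) (u : H ι) : ‖U A c t u‖ = ‖u‖ := by
  have h := inner_U_U hA c 0 t u u
  rw [zero_add, U_zero hA, real_inner_self_eq_norm_sq, real_inner_self_eq_norm_sq] at h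
  exact (sq_eq_sq₀ (norm_nonneg _) (norm_nonneg _)).1 h

lemma inner_U_right (hA : IsClifford A) (c t : ℝ) (u v : H ι) :
    inner ℝ u (U A c t v) = inner ℝ (U A c (-t) u) v := by
  have h := inner_U_U hA c (-t) t u v
  rwa [neg_add_cancel, U_zero hA] at h

lemma U_U (hA : IsClifford A) (c s t : ℝ) (u : H ι) : U A c s (U A c t u) = U A c (s + t) u := by
  refine ext_inner_left ℝ fun v => ?_
  have h := inner_U_U hA c (s + t) (-s) u v
  rw [show s + t + -s = t by ring] at h
  rw [inner_U_right hA, real_inner_comm, h, real_inner_comm]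

/-- The operators are isometries, hence 1-Lipschitz uniformly in `t`; continuity in `t` on the dense
set of test tuples then gives joint continuity. -/
lemma continuous_U (hA : IsClifford A) (c : ℝ) : Continuous fun p : H ι × ℝ => U A c p.2 p.1 := by
  refine continuous_prod_of_dense_continuous_lipschitzWith _ 1 denseRange_testH ?_ fun t => ?_
  · rintro _ ⟨Φ, rfl⟩
    simp only [U_testH hA]
    exact continuous_toH fun k => isTestCurve_flow c Φ k
  · refine LipschitzWith.of_dist_le_mul fun u v => ?_
    rw [dist_eq_norm, dist_eq_norm, ← map_sub, norm_U hA]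
    simp

lemma hasDerivAt_U_testH (hA : IsClifford A) (c : ℝ) (Φ : ι → Test) :
    HasDerivAt (fun t => U A c t (testH Φ)) (c • toH fun k => dirac A (fun k _ => Φ k) k 0) 0 := by
  simp only [U_testH hA]
  convert hasDerivAt_toH (fun k => isTestCurve_flow (A := A) c Φ k) 0 using 1
  rw [← toH_const_mul fun k => (isTestCurve_dirac (fun k => Test.isTestCurve (Φ k)) k).memLp 0]
  congr 1
  funext k x
  rw [pderiv_time_flow hA]
  simp only [dirac, (isTestCurve_flow c Φ _).pderiv_space, (Test.isTestCurve _).pderiv_space,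
    flow_zero]

end

/-! ### The fundamental theorem of calculus for weak derivatives in time -/

lemma integral_eq_zero_of_hasCompactSupport {f f' : ℝ → ℝ} (hf : HasCompactSupport f)
    (hd : ∀ t, HasDerivAt f (f' t) t) (hc : Continuous f') : ∫ t, f' t = 0 := by
  have h1 : f' = deriv f := funext fun t => (hd t).deriv.symm
  have h2 : HasCompactSupport f' := h1 ▸ hf.deriv
  exact integral_eq_zero_of_hasDerivAt_of_integrable hd (hc.integrable_of_hasCompactSupport h2)
    ((continuous_iff_continuousAt.2 fun t => (hd t).continuousAt).integrable_of_hasCompactSupport hf)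

/-- The primitive from `-∞` vanishes to the left of the support and equals the total integral, which
is zero, to the right of it. -/
lemma exists_antideriv_of_integral_eq_zero {g : ℝ → ℝ} (hg : ContDiff ℝ ∞ g)
    (hg' : HasCompactSupport g) (h0 : ∫ t, g t = 0) :
    ∃ η : ℝ → ℝ, ContDiff ℝ ∞ η ∧ HasCompactSupport η ∧ ∀ t, HasDerivAt η (g t) t := by
  obtain ⟨R, hR⟩ := exists_norm_bound_of_hasCompactSupport hg'
  have hint : Integrable g := hg.continuous.integrable_of_hasCompactSupport hg'
  let η : ℝ → ℝ := fun s => ∫ r in Set.Iic s, g r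
  have hd (t : ℝ) : HasDerivAt η (g t) t := by
    have h1 : η = fun s => (∫ r in Set.Iic (0 : ℝ), g r) + ∫ r in (0 : ℝ)..s, g r := by
      funext s
      have := intervalIntegral.integral_Iic_sub_Iic (a := 0) (b := s) (f := g) (μ := volume)
        hint.integrableOn hint.integrableOn
      simp only [η]
      linarith
    rw [h1]
    exact (intervalIntegral.integral_hasDerivAt_right (hg.continuous.intervalIntegrable _ _)
      (hg.continuous.stronglyMeasurableAtFilter _ _) hg.continuous.continuousAt).const_add _
  refine ⟨η, ?_, ?_, hd⟩
  · rw [contDiff_infty_iff_deriv]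
    refine ⟨fun t => (hd t).differentiableAt, ?_⟩
    rwa [show deriv η = g from funext fun t => (hd t).deriv]
  · refine HasCompactSupport.intro (isCompact_closedBall (0 : ℝ) R) fun s hs => ?_
    simp only [mem_closedBall_zero_iff, not_le, Real.norm_eq_abs] at hs
    rcases lt_or_ge s 0 with h | h
    · refine setIntegral_eq_zero_of_forall_eq_zero fun r hr => hR r ?_
      rw [abs_of_neg h] at hs
      have hr' : r ≤ s := hr
      rw [Real.norm_eq_abs, abs_of_neg (by linarith)]
      linarith
    · rw [abs_of_nonneg h] at hs
      have := setIntegral_eq_integral_of_forall_compl_eq_zero (s := Set.Iic s) (f := g)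
        (μ := volume) fun r hr => hR r (by
          have hr' : s < r := not_le.1 hr
          rw [Real.norm_eq_abs, abs_of_pos (by linarith)]
          linarith)
      exact this.trans h0

/-- A continuous function with the weak derivative `k` is a primitive of `k`. -/
lemma sub_eq_integral_of_weak_deriv {h k : ℝ → ℝ} (hh : Continuous h) (hk : Continuous k)
    (H : ∀ η η' : ℝ → ℝ, ContDiff ℝ ∞ η → HasCompactSupport η → (∀ t, HasDerivAt η (η' t) t) →
      Continuous η' → ∫ t, (η' t * h t + η t * k t) = 0) (a b : ℝ) :
    h b - h a = ∫ t in a..b, k t := by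
  let w : ℝ → ℝ := fun s => h s - ∫ r in (0 : ℝ)..s, k r
  have hKd (t : ℝ) : HasDerivAt (fun s => ∫ r in (0 : ℝ)..s, k r) (k t) t :=
    intervalIntegral.integral_hasDerivAt_right (hk.intervalIntegrable _ _)
      (hk.stronglyMeasurableAtFilter _ _) hk.continuousAt
  have hKc : Continuous fun s => ∫ r in (0 : ℝ)..s, k r :=
    continuous_iff_continuousAt.2 fun t => (hKd t).continuousAt
  have hw : Continuous w := hh.sub hKc
  -- The argument of du Bois-Reymond: a test function of mean zero is the derivative of a test
  -- function, hence `w` is orthogonal to it.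
  have key {g : ℝ → ℝ} (hg : ContDiff ℝ ∞ g) (hg' : HasCompactSupport g) (h0 : ∫ t, g t = 0) :
      ∫ t, g t * w t = 0 := by
    obtain ⟨η, hη, hη', hd⟩ := exists_antideriv_of_integral_eq_zero hg hg' h0
    have h1 := H η g hη hη' hd hg.continuous
    have h2 := integral_eq_zero_of_hasCompactSupport (f := fun t => η t * ∫ r in (0 : ℝ)..t, k r)
      (hη'.mul_right) (fun t => (hd t).mul (hKd t))
      ((hg.continuous.mul hKc).add (hη.continuous.mul hk))
    have i1 : Integrable fun t => g t * h t + η t * k t :=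
      ((hg.continuous.mul hh).integrable_of_hasCompactSupport hg'.mul_right).add
        ((hη.continuous.mul hk).integrable_of_hasCompactSupport hη'.mul_right)
    have i2 : Integrable fun t => g t * (∫ r in (0 : ℝ)..t, k r) + η t * k t :=
      ((hg.continuous.mul hKc).integrable_of_hasCompactSupport hg'.mul_right).add
        ((hη.continuous.mul hk).integrable_of_hasCompactSupport hη'.mul_right)
    have h3 := integral_sub i1 i2
    rw [h1, h2, sub_zero] at h3
    rw [← h3]
    refine integral_congr_ae (Filter.Eventually.of_forall fun t => ?_)
    simp only [w]
    ring
  -- Subtracting a multiple of a fixed `θ` of integral 1 gives any test function mean zero.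
  -- Therefore `w` equals the constant `∫ θ w`.
  let b₀ : ContDiffBump (0 : ℝ) := ⟨1, 2, one_pos, one_lt_two⟩
  let θ : ℝ → ℝ := b₀.normed volume
  have hθ : ContDiff ℝ ∞ θ := b₀.contDiff_normed
  have hθ' : HasCompactSupport θ := b₀.hasCompactSupport_normed
  have hθ1 : ∫ t, θ t = 1 := b₀.integral_normed
  have iθ : Integrable θ := hθ.continuous.integrable_of_hasCompactSupport hθ'
  have iθw : Integrable fun t => θ t * w t :=
    (hθ.continuous.mul hw).integrable_of_hasCompactSupport hθ'.mul_right
  set C := ∫ t, θ t * w t with hC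
  have hae : ∀ᵐ t, w t - C = 0 := by
    refine ae_eq_zero_of_integral_contDiff_smul_eq_zero
      ((hw.sub continuous_const).locallyIntegrable) fun g hg hg' => ?_
    have ig : Integrable g := hg.continuous.integrable_of_hasCompactSupport hg'
    have igw : Integrable fun t => g t * w t :=
      (hg.continuous.mul hw).integrable_of_hasCompactSupport hg'.mul_right
    have h1 := key (g := fun t => g t - (∫ s, g s) * θ t) (hg.sub (contDiff_const.mul hθ))
      (hg'.sub hθ'.mul_left) (by
        rw [integral_sub ig (iθ.const_mul _), integral_const_mul, hθ1, mul_one, sub_self])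
    have h2 : ∀ t, (g t - (∫ s, g s) * θ t) * w t = g t * w t - (∫ s, g s) * (θ t * w t) :=
      fun t => by ring
    simp only [h2] at h1
    rw [integral_sub igw (iθw.const_mul _), integral_const_mul, ← hC] at h1
    simp only [smul_eq_mul, mul_sub]
    rw [integral_sub igw (ig.mul_const _), integral_mul_const]
    exact h1
  have heq : w = fun _ => C := by
    refine (hw.ae_eq_iff_eq volume continuous_const).1 ?_
    filter_upwards [hae] with t ht
    exact sub_eq_zero.1 ht
  have hb : h b - ∫ r in (0 : ℝ)..b, k r = C := congrFun heq b
  have ha : h a - ∫ r in (0 : ℝ)..a, k r = C := congrFun heq a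
  have := intervalIntegral.integral_interval_sub_left (hk.intervalIntegrable (μ := volume) 0 b)
    (hk.intervalIntegrable 0 a)
  linarith

section

/-! ### Weak conservation laws -/

/-- The pairing of `-∂ₜ f - ∑ ∂ᵢ gᵢ + r` with a test curve, at a fixed time. -/
def lawForm (f : ℝ → L2) (g : Fin 3 → ℝ → L2) (r : ℝ → L2) (F : ℝ → Space → ℝ) (t : ℝ) : ℝ :=
  inner ℝ (f t) (toL2 (pderiv timeDir F t))
    + ∑ i, inner ℝ (g i t) (toL2 (pderiv (spaceDir i) F t)) + inner ℝ (r t) (toL2 (F t))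

/-- The equation `∂ₜ f + ∑ ∂ᵢ gᵢ = r` in the sense of distributions on `ℝ × ℝ³`. -/
def IsLaw (f : ℝ → L2) (g : Fin 3 → ℝ → L2) (r : ℝ → L2) : Prop :=
  ∀ φ : STTest, ∫ t, lawForm f g r (fun t x => φ (t, x)) t = 0

section law

variable {f r : ℝ → L2} {g : Fin 3 → ℝ → L2}

lemma continuous_lawForm (hf : Continuous f) (hg : ∀ i, Continuous (g i)) (hr : Continuous r)
    {F : ℝ → Space → ℝ} (hF : IsTestCurve F) : Continuous (lawForm f g r F) :=
  ((hf.inner (hF.pderiv _).continuous_toL2).add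
    (continuous_finsetSum _ fun i _ => (hg i).inner (hF.pderiv _).continuous_toL2)).add
    (hr.inner hF.continuous_toL2)

/-- Integrated form of a weak conservation law. -/
lemma IsLaw.inner_sub_inner (h : IsLaw f g r) (hf : Continuous f) (hg : ∀ i, Continuous (g i))
    (hr : Continuous r) {F : ℝ → Space → ℝ} (hF : IsTestCurve F) (a b : ℝ) :
    inner ℝ (f b) (toL2 (F b)) - inner ℝ (f a) (toL2 (F a)) = ∫ t in a..b, lawForm f g r F t := by
  refine sub_eq_integral_of_weak_deriv (h := fun t => inner ℝ (f t) (toL2 (F t)))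
    (hf.inner hF.continuous_toL2) (continuous_lawForm hf hg hr hF) ?_ a b
  intro η η' hη hη' hd _
  have hG := hF.mul_left hη
  -- The law is tested with `η(t) F(t, x)`: the time derivative splits by the product rule, and the
  -- other terms just carry the factor `η`.
  rw [← h (hF.toSTTest hη hη')]
  refine integral_congr_ae (Filter.Eventually.of_forall fun t => ?_)
  have h0 : (fun t x => hF.toSTTest hη hη' (t, x)) = fun t x => η t * F t x := rfl
  have h1 : toL2 (pderiv timeDir (fun t x => η t * F t x) t)
      = η' t • toL2 (F t) + η t • toL2 (pderiv timeDir F t) := by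
    rw [← toL2_const_mul (hF.memLp t), ← toL2_const_mul ((hF.pderiv _).memLp t),
      ← toL2_add ((hF.memLp t).const_mul _) (((hF.pderiv _).memLp t).const_mul _)]
    congr 1
    funext x
    exact (hG.hasDerivAt_time t x).unique ((hd t).mul (hF.hasDerivAt_time t x))
  have h2 (i : Fin 3) : toL2 (pderiv (spaceDir i) (fun t x => η t * F t x) t)
      = η t • toL2 (pderiv (spaceDir i) F t) := by
    rw [← toL2_const_mul ((hF.pderiv _).memLp t)]
    congr 1
    funext x
    rw [hG.pderiv_space, hF.pderiv_space,
      fderiv_const_mul ((hF.smooth_slice t).differentiable (by simp) x)]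
    rfl
  have h3 : toL2 (fun x => η t * F t x) = η t • toL2 (F t) := toL2_const_mul (hF.memLp t) _
  rw [h0]
  simp only [lawForm, h1, h2, h3, inner_add_right, inner_smul_right, ← Finset.mul_sum]
  ring

end law

/-! ### Weak solutions of first order systems -/

variable {ι : Type} [Fintype ι] {A : Fin 3 → Matrix ι ι ℝ}

/-- The fluxes of the system `∂ₜ V = c ∑ Aᵢ ∂ᵢ V + S`. -/
def flux (A : Fin 3 → Matrix ι ι ℝ) (c : ℝ) (V : ℝ → H ι) (k : ι) (i : Fin 3) (t : ℝ) : L2 :=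
  (-c) • ∑ l, A i k l • V t l

/-- The equation `∂ₜ V = c ∑ Aᵢ ∂ᵢ V + S` in the sense of distributions. -/
def IsWeakSolution (A : Fin 3 → Matrix ι ι ℝ) (c : ℝ) (V S : ℝ → H ι) : Prop :=
  ∀ k, IsLaw (fun t => V t k) (flux A c V k) (fun t => S t k)

lemma continuous_coord {V : ℝ → H ι} (hV : Continuous V) (k : ι) : Continuous fun t => V t k :=
  (PiLp.continuous_apply 2 (fun _ : ι => L2) k).comp hV

lemma continuous_flux {V : ℝ → H ι} (hV : Continuous V) (c : ℝ) (k : ι) (i : Fin 3) :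
    Continuous (flux A c V k i) := by
  have h := continuous_coord hV
  unfold flux
  fun_prop

/-- Symmetry moves the matrices onto the test tuple. Since D is skew, the adjoint equation is the
equation itself, so the first term disappears when `F` is a classical solution. -/
lemma sum_lawForm (hA : ∀ i k l, A i k l = A i l k) (c : ℝ) (V S : ℝ → H ι)
    {F : ι → ℝ → Space → ℝ} (hF : ∀ k, IsTestCurve (F k)) (t : ℝ) :
    ∑ k, lawForm (fun t => V t k) (flux A c V k) (fun t => S t k) (F k) t =
      inner ℝ (V t) ((toH fun k => pderiv timeDir (F k) t) - c • toH fun k => dirac A F k t)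
        + inner ℝ (S t) (toH fun k => F k t) := by
  simp only [lawForm, Finset.sum_add_distrib, inner_sub_right, inner_smul_right, inner_toH,
    toL2_dirac hF, flux, inner_sum, sum_inner, inner_smul_left, RCLike.conj_to_real]
  congr 1
  rw [sub_eq_add_neg]
  congr 1
  simp only [Finset.mul_sum, ← Finset.sum_neg_distrib]
  rw [Finset.sum_comm]
  conv_rhs => rw [Finset.sum_comm]
  refine Finset.sum_congr rfl fun i _ => ?_
  rw [Finset.sum_comm]
  refine Finset.sum_congr rfl fun k _ => Finset.sum_congr rfl fun l _ => ?_
  rw [hA i l k]; ring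

variable [DecidableEq ι]

/-- A product rule. Around `s = t`, the difference quotient of `U(t - s) y(s)` is `U(t - s)` applied
to that of `y`, plus that of `U(t - s)` on the fixed test tuple `y(t)`. Joint continuity handles the
first, the generator the second; applying `U(-t)` finishes. -/
lemma hasDerivAt_U_curve (hA : IsClifford A) (c : ℝ) {F : ι → ℝ → Space → ℝ}
    (hF : ∀ k, IsTestCurve (F k)) (t : ℝ) :
    HasDerivAt (fun s => U A c (-s) (toH fun k => F k s))
      (U A c (-t) ((toH fun k => pderiv timeDir (F k) t) - c • toH fun k => dirac A F k t)) t := by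
  let y : ℝ → H ι := fun s => toH fun k => F k s
  have h1 : HasDerivAt (fun s => U A c (t - s) (y t)) (-(c • toH fun k => dirac A F k t)) t := by
    have h := hasDerivAt_U_testH hA c fun k => (hF k).slice t
    have hd : (toH fun k => dirac A (fun k _ => (hF k).slice t) k 0)
        = toH fun k => dirac A F k t := by
      congr 1
      funext k x
      simp only [dirac, (hF _).pderiv_space, (Test.isTestCurve _).pderiv_space]
      rfl
    rw [hd] at h
    have h2 : HasDerivAt (fun s => t - s) (-1) t := by
      simpa using (hasDerivAt_id t).const_sub t
    have h3 := HasDerivAt.scomp_of_eq (g₁ := fun s => U A c s (testH fun k => (hF k).slice t))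
      t h h2 (sub_self t).symm
    rw [neg_one_smul] at h3
    exact h3
  have hU := continuous_U hA c
  have h2 : HasDerivAt (fun s => U A c (t - s) (y s))
      ((toH fun k => pderiv timeDir (F k) t) - c • toH fun k => dirac A F k t) t := by
    rw [hasDerivAt_iff_tendsto_slope] at h1 ⊢
    have h3 := hasDerivAt_iff_tendsto_slope.1 (hasDerivAt_toH hF t)
    have h4 : Filter.Tendsto (fun s : ℝ => t - s) (nhdsWithin t {t}ᶜ) (nhds (t - t)) :=
      ((continuous_const.sub continuous_id).tendsto t).mono_left nhdsWithin_le_nhds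
    have h5 := (hU.tendsto (_, t - t)).comp (h3.prodMk_nhds h4)
    simp only [sub_self, U_zero hA] at h5
    rw [sub_eq_add_neg]
    refine (h5.add h1).congr fun s => ?_
    simp only [Function.comp, slope_def_module, y, map_smul, map_sub, sub_self]
    rw [← smul_add]
    congr 1
    abel
  have h3 := (U A c (-t)).hasFDerivAt.comp_hasDerivAt t h2
  refine h3.congr_of_eventuallyEq (Filter.Eventually.of_forall fun s => ?_)
  simp only [Function.comp, U_U hA]
  congr 2
  ring

/-- Duhamel's formula. -/
def duhamel (A : Fin 3 → Matrix ι ι ℝ) (c : ℝ) (V₀ : H ι) (S : ℝ → H ι) (t : ℝ) : H ι :=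
  U A c t (V₀ + ∫ s in (0 : ℝ)..t, U A c (-s) (S s))

lemma continuous_U_source (hA : IsClifford A) (c : ℝ) {S : ℝ → H ι} (hS : Continuous S) :
    Continuous fun s => U A c (-s) (S s) := by
  have h := (continuous_U hA c).comp (hS.prodMk continuous_neg)
  exact h

lemma hasDerivAt_duhamel_integral (hA : IsClifford A) (c : ℝ) (V₀ : H ι) {S : ℝ → H ι}
    (hS : Continuous S) (t : ℝ) :
    HasDerivAt (fun t => V₀ + ∫ s in (0 : ℝ)..t, U A c (-s) (S s)) (U A c (-t) (S t)) t := by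
  have h := continuous_U_source hA c hS
  exact (intervalIntegral.integral_hasDerivAt_right (h.intervalIntegrable _ _)
      (h.stronglyMeasurableAtFilter _ _) h.continuousAt).const_add _

lemma continuous_duhamel (hA : IsClifford A) (c : ℝ) (V₀ : H ι) {S : ℝ → H ι}
    (hS : Continuous S) : Continuous (duhamel A c V₀ S) := by
  have h1 : Continuous fun t => V₀ + ∫ s in (0 : ℝ)..t, U A c (-s) (S s) :=
    continuous_iff_continuousAt.2 fun t => (hasDerivAt_duhamel_integral hA c V₀ hS t).continuousAt
  have h := (continuous_U hA c).comp (h1.prodMk continuous_id)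
  exact h

lemma duhamel_zero (hA : IsClifford A) (c : ℝ) (V₀ : H ι) (S : ℝ → H ι) :
    duhamel A c V₀ S 0 = V₀ := by
  simp [duhamel, U_zero hA]

/-- Duhamel's curve need not be differentiable in `H ι`. In the pairing `U(t)` moves to the test
curve as `U(-t)`, and then both factors are differentiable. -/
lemma hasDerivAt_inner_duhamel (hA : IsClifford A) (c : ℝ) (V₀ : H ι) {S : ℝ → H ι}
    (hS : Continuous S) {F : ι → ℝ → Space → ℝ} (hF : ∀ k, IsTestCurve (F k)) (t : ℝ) :
    HasDerivAt (fun t => inner ℝ (duhamel A c V₀ S t) (toH fun k => F k t))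
      (∑ k, lawForm (fun t => duhamel A c V₀ S t k) (flux A c (duhamel A c V₀ S) k)
        (fun t => S t k) (F k) t) t := by
  have hadj (s : ℝ) (u v : H ι) : inner ℝ (U A c s u) v = inner ℝ u (U A c (-s) v) := by
    rw [inner_U_right hA, neg_neg]
  have h := (hasDerivAt_duhamel_integral hA c V₀ hS t).inner ℝ (hasDerivAt_U_curve hA c hF t)
  rw [sum_lawForm hA.symm c _ S hF]
  simp only [duhamel, hadj]
  refine h.congr_deriv ?_
  congr 1
  rw [← hadj, U_U hA, add_neg_cancel, U_zero hA]

/-- For a test tuple whose only nonzero entry is the `k`-th, the sum of the laws is the `k`-th law.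
Its integrand is the derivative of a compactly supported function of time. -/
lemma isWeakSolution_duhamel (hA : IsClifford A) (c : ℝ) (V₀ : H ι) {S : ℝ → H ι}
    (hS : Continuous S) : IsWeakSolution A c (duhamel A c V₀ S) S := by
  intro k φ
  let F : ι → ℝ → Space → ℝ := fun l t x => if l = k then φ (t, x) else 0
  have hF (l : ι) : IsTestCurve (F l) := by
    by_cases h : l = k
    · simpa [F, h] using STTest.isTestCurve φ
    · simpa [F, h] using IsTestCurve.zero
  have hFk : F k = fun t x => φ (t, x) := by simp [F]
  have hV := continuous_duhamel hA c V₀ hS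
  have hc (l : ι) := continuous_lawForm (continuous_coord hV l) (continuous_flux (A := A) hV c l)
    (continuous_coord hS l) (hF l)
  have hz (t : ℝ) : ∑ l, lawForm (fun t => duhamel A c V₀ S t l) (flux A c (duhamel A c V₀ S) l)
      (fun t => S t l) (F l) t = lawForm (fun t => duhamel A c V₀ S t k)
        (flux A c (duhamel A c V₀ S) k) (fun t => S t k) (fun t x => φ (t, x)) t := by
    rw [Finset.sum_eq_single k, hFk]
    · intro l _ hl
      have h0 : F l = fun _ _ => 0 := by simp [F, hl]
      have h2 (v : ℝ × Space) : pderiv v (fun _ _ => 0) t = fun _ => (0 : ℝ) := by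
        funext x; simp [pderiv]
      simp [h0, lawForm, toL2_zero, h2]
    · simp
  have hsupp : HasCompactSupport fun t => inner ℝ (duhamel A c V₀ S t) (toH fun k => F k t) := by
    obtain ⟨R, hR⟩ := exists_norm_bound_of_hasCompactSupport φ.hasCompactSupport
    refine HasCompactSupport.intro (isCompact_closedBall (0 : ℝ) R) fun t ht => ?_
    have h0 : (fun k => F k t) = fun _ _ => 0 := by
      funext l x
      have : φ (t, x) = 0 := hR _ (by
        simp only [mem_closedBall_zero_iff, not_le] at ht
        exact ht.trans_le (by simp [Prod.norm_def]))
      simp [F, this]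
    have h1 : (toH fun (_ : ι) (_ : Space) => (0 : ℝ)) = 0 := by
      simpa using toH_const_mul (f := fun (_ : ι) (_ : Space) => (0 : ℝ)) (fun _ => MemLp.zero) 0
    rw [h0, h1, inner_zero_right]
  have h := integral_eq_zero_of_hasCompactSupport hsupp
    (fun t => hasDerivAt_inner_duhamel hA c V₀ hS hF t) (continuous_finsetSum _ fun l _ => hc l)
  simpa only [hz] using h

/-- Weak solutions are given by the classical flow of test functions. -/
lemma IsWeakSolution.inner_testH (hA : IsClifford A) {c : ℝ} {V S : ℝ → H ι}
    (h : IsWeakSolution A c V S) (hV : Continuous V) (hS : Continuous S) (Φ : ι → Test) (t : ℝ) :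
    inner ℝ (V t) (testH Φ) = inner ℝ (V 0) (toH fun k => flow A c Φ k (-t))
      + ∫ s in (0 : ℝ)..t, inner ℝ (S s) (toH fun k => flow A c Φ k (s - t)) := by
  -- The classical solution that equals `Φ` at time `t`. The adjoint equation annihilates it, so
  -- only the source contributes to the integral.
  let F : ι → ℝ → Space → ℝ := fun k s => flow A c Φ k (1 * s + (-t))
  have hF (k : ι) : IsTestCurve (F k) := (isTestCurve_flow c Φ k).comp_affine 1 (-t)
  have h1 (k : ι) := (h k).inner_sub_inner (continuous_coord hV k) (continuous_flux hV c k)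
    (continuous_coord hS k) (hF k) 0 t
  have hc (k : ι) := continuous_lawForm (continuous_coord hV k) (continuous_flux (A := A) hV c k)
    (continuous_coord hS k) (hF k)
  have h2 := Finset.sum_congr rfl fun k (_ : k ∈ Finset.univ) => h1 k
  rw [Finset.sum_sub_distrib, ← intervalIntegral.integral_finsetSum fun k _ =>
    (hc k).intervalIntegrable 0 t] at h2
  have h3 (s : ℝ) : (toH fun k => pderiv timeDir (F k) s) - (c • toH fun k => dirac A F k s) = 0 := by
    rw [sub_eq_zero, ← toH_const_mul fun k => (isTestCurve_dirac hF k).memLp s]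
    congr 1
    funext k x
    rw [pderiv_time_comp_affine (isTestCurve_flow c Φ k), pderiv_time_flow hA, one_mul]
    simp only [dirac, F, pderiv_space_comp_affine (isTestCurve_flow c Φ _)]
  simp only [sum_lawForm hA.symm c V S hF, h3, inner_zero_right, zero_add] at h2
  have h4 : (toH fun k => F k t) = testH Φ := by
    simp only [F, one_mul, add_neg_cancel, flow_zero]; rfl
  have h5 (s : ℝ) : (toH fun k => F k s) = toH fun k => flow A c Φ k (s - t) := by
    simp only [F, one_mul, ← sub_eq_add_neg]
  have h6 (s : ℝ) : ∑ k, inner ℝ (V s k) (toL2 (F k s)) = inner ℝ (V s) (toH fun k => F k s) :=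
    (inner_toH _ _).symm
  rw [h6, h6, h4, h5 0] at h2
  simp only [h5, zero_sub] at h2
  linarith

lemma inner_duhamel_testH (hA : IsClifford A) (c : ℝ) (V₀ : H ι) {S : ℝ → H ι}
    (hS : Continuous S) (Φ : ι → Test) (t : ℝ) :
    inner ℝ (duhamel A c V₀ S t) (testH Φ) = inner ℝ V₀ (toH fun k => flow A c Φ k (-t))
      + ∫ s in (0 : ℝ)..t, inner ℝ (S s) (toH fun k => flow A c Φ k (s - t)) := by
  have h := (isWeakSolution_duhamel hA c V₀ hS).inner_testH hA (continuous_duhamel hA c V₀ hS) hS Φ t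
  rwa [duhamel_zero hA] at h

/-- Weak solutions are given by Duhamel's formula. -/
lemma IsWeakSolution.eq_duhamel (hA : IsClifford A) {c : ℝ} {V S : ℝ → H ι}
    (h : IsWeakSolution A c V S) (hV : Continuous V) (hS : Continuous S) (t : ℝ) :
    V t = duhamel A c (V 0) S t :=
  ext_inner_testH fun Φ => by rw [h.inner_testH hA hV hS, inner_duhamel_testH hA c _ hS]

/-- Energy balance. -/
lemma hasDerivAt_norm_sq_duhamel (hA : IsClifford A) (c : ℝ) (V₀ : H ι) {S : ℝ → H ι}
    (hS : Continuous S) (t : ℝ) :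
    HasDerivAt (fun t => ‖duhamel A c V₀ S t‖ ^ 2) (2 * inner ℝ (duhamel A c V₀ S t) (S t)) t := by
  -- As `U(t)` is isometric, the norm is that of `V₀` plus the integral, which is differentiable in
  -- norm.
  have h := (hasDerivAt_duhamel_integral hA c V₀ hS t).norm_sq
  simp only [duhamel, norm_U hA]
  rwa [inner_U_right hA, neg_neg] at h

end

/-! ### Components of vector fields -/

/-- The `i`-th component of a square integrable vector field. -/
def coord (i : Fin 3) : L2V →L[ℝ] L2 :=
  (EuclideanSpace.proj i : Space →L[ℝ] ℝ).compLpL 2 volume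

lemma coord_ae (i : Fin 3) (F : L2V) : coord i F =ᵐ[volume] fun x => F x i :=
  (EuclideanSpace.proj i : Space →L[ℝ] ℝ).coeFn_compLpL F

/-- The vector field with given components. -/
def ofCoords (f : Fin 3 → L2) : L2V :=
  ∑ i, (ContinuousLinearMap.toSpanSingleton ℝ (e i)).compLpL 2 volume (f i)

lemma coord_ofCoords (f : Fin 3 → L2) (i : Fin 3) : coord i (ofCoords f) = f i := by
  simp only [ofCoords, map_sum, coord]
  rw [Finset.sum_eq_single i]
  · ext1
    filter_upwards [(EuclideanSpace.proj i : Space →L[ℝ] ℝ).coeFn_compLpL (p := 2) (μ := volume)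
      ((ContinuousLinearMap.toSpanSingleton ℝ (e i)).compLpL 2 volume (f i)),
      (ContinuousLinearMap.toSpanSingleton ℝ (e i)).coeFn_compLpL (f i)] with x h1 h2
    rw [h1, h2]
    simp
  · intro j _ hj
    ext1
    filter_upwards [(EuclideanSpace.proj i : Space →L[ℝ] ℝ).coeFn_compLpL (p := 2) (μ := volume)
      ((ContinuousLinearMap.toSpanSingleton ℝ (e j)).compLpL 2 volume (f j)),
      (ContinuousLinearMap.toSpanSingleton ℝ (e j)).coeFn_compLpL (f j),
      Lp.coeFn_zero ℝ 2 (volume : Measure Space)] with x h1 h2 h3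
    rw [h1, h2, h3]
    simp [hj.symm]
  · simp

lemma continuous_ofCoords {f : ℝ → Fin 3 → L2} (hf : ∀ i, Continuous fun t => f t i) :
    Continuous fun t => ofCoords (f t) :=
  continuous_finsetSum _ fun i _ => (ContinuousLinearMap.continuous _).comp (hf i)

lemma ext_coord {F G : L2V} (h : ∀ i, coord i F = coord i G) : F = G := by
  ext1
  have h1 (i : Fin 3) : (fun x => F x i) =ᵐ[volume] fun x => G x i :=
    (coord_ae i F).symm.trans ((h i ▸ Filter.EventuallyEq.rfl : coord i F =ᵐ[volume] coord i G).trans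
      (coord_ae i G))
  filter_upwards [h1 0, h1 1, h1 2] with x h0 h1 h2
  ext i
  fin_cases i <;> assumption

lemma inner_coord (i : Fin 3) (F : L2V) {f : Space → ℝ} (hf : MemLp f 2 volume) :
    inner ℝ (coord i F) (toL2 f) = ∫ x, F x i * f x := by
  rw [inner_toL2 _ hf]
  refine integral_congr_ae ?_
  filter_upwards [coord_ae i F] with x hx
  rw [hx]

lemma sum_norm_sq_coord (F : L2V) : ∑ i, ‖coord i F‖ ^ 2 = ∫ x, ‖F x‖ ^ 2 := by
  have h (i : Fin 3) : ‖coord i F‖ ^ 2 = ∫ x, (F x i) ^ 2 := by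
    rw [← real_inner_self_eq_norm_sq, L2.inner_def]
    refine integral_congr_ae ?_
    filter_upwards [coord_ae i F] with x hx
    rw [hx]; simp
  have hi (i : Fin 3) : Integrable fun x => (F x i) ^ 2 := by
    refine ((Lp.memLp (coord i F)).integrable_sq).congr ?_
    filter_upwards [coord_ae i F] with x hx
    rw [hx]
  simp only [h]
  rw [← integral_finsetSum _ fun i _ => hi i]
  simp only [EuclideanSpace.real_norm_sq_eq]

lemma integrable_norm_sq (F : L2V) : Integrable fun x => ‖F x‖ ^ 2 :=
  (memLp_two_iff_integrable_sq_norm (Lp.memLp F).1).1 (Lp.memLp F)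

/-! ### The Maxwell equations as a first order system -/

/-- The components of the electric and the magnetic field, and two auxiliary scalar fields. -/
abbrev Idx : Type := (Fin 3 ⊕ Fin 3) ⊕ (Unit ⊕ Unit)

/-- The totally antisymmetric symbol. -/
def levi (i j k : Fin 3) : ℤ :=
  if j = i + 1 ∧ k = i + 2 then 1 else if j = i + 2 ∧ k = i + 1 then -1 else 0

/-- The coefficients of the system `∂ₜE = rot B - ∇f`, `∂ₜB = -rot E - ∇g`, `∂ₜf = -div E`,
`∂ₜg = -div B`. -/
def maxwellCoeff (i : Fin 3) : Matrix Idx Idx ℤ :=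
  Matrix.fromBlocks
    (Matrix.fromBlocks 0 (Matrix.of fun k l => levi k i l) (Matrix.of fun k l => -levi k i l) 0)
    (Matrix.fromBlocks (Matrix.of fun k _ => if k = i then -1 else 0) 0 0
      (Matrix.of fun k _ => if k = i then -1 else 0))
    (Matrix.fromBlocks (Matrix.of fun _ k => if k = i then -1 else 0) 0 0
      (Matrix.of fun _ k => if k = i then -1 else 0)) 0

/-- The real coefficients of the Maxwell system. -/
def maxwellMat (i : Fin 3) : Matrix Idx Idx ℝ := (maxwellCoeff i).map (Int.castRingHom ℝ)

/-- The curl blocks alone square to `-rot rot = Δ - ∇div`; the scalar fields supply the missing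
`∇div`, while `div rot = 0` and `rot ∇ = 0` remove the mixed terms. The integer entries make both
properties finite checks, which are then cast to `ℝ`. -/
lemma isClifford_maxwellMat : IsClifford maxwellMat where
  symm := by
    have h : ∀ i, (maxwellCoeff i).transpose = maxwellCoeff i := by decide +kernel
    intro i k l
    simp only [maxwellMat, Matrix.map_apply]
    rw [← Matrix.transpose_apply (maxwellCoeff i), h i]
  anticomm := by
    have h : ∀ i j, maxwellCoeff i * maxwellCoeff j + maxwellCoeff j * maxwellCoeff i
        = if i = j then 2 else 0 := by decide +kernel
    intro i j
    have h1 := congrArg (fun m => (Int.castRingHom ℝ).mapMatrix m) (h i j)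
    simp only [map_add, map_mul] at h1
    change _ = (if i = j then (2 : Matrix Idx Idx ℝ) else 0)
    refine h1.trans ?_
    split_ifs
    · exact map_ofNat (Int.castRingHom ℝ).mapMatrix 2
    · exact map_zero (Int.castRingHom ℝ).mapMatrix

/-- The pairing on space-time of a curve in `L²` with a test curve. -/
def pairL2 (f : ℝ → L2) (F : ℝ → Space → ℝ) : ℝ := ∫ t, inner ℝ (f t) (toL2 (F t))

lemma pair_eq_pairL2 (f : ℝ → L2) (φ : STTest) :
    pair (fun t => f t) φ = pairL2 f fun t x => φ (t, x) := by
  simp only [pair, pairL2]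
  congr 1
  funext t
  rw [inner_toL2 _ ((STTest.isTestCurve φ).memLp t)]

lemma pair_comp_eq_pairL2 (F : ℝ → L2V) (i : Fin 3) (φ : STTest) :
    pair (comp F i) φ = pairL2 (fun t => coord i (F t)) fun t x => φ (t, x) := by
  simp only [pair, pairL2]
  congr 1
  funext t
  rw [inner_coord _ _ ((STTest.isTestCurve φ).memLp t)]
  rfl

lemma lineDeriv_curve (φ : STTest) (v : ℝ × Space) :
    (fun t x => (∂_{v} φ) (t, x)) = pderiv v fun t x => φ (t, x) := by
  funext t x
  exact stTest_lineDeriv_apply φ v t x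

lemma dt_eq (f : ℝ → L2) (φ : STTest) :
    dt (fun t => f t) φ = -pairL2 f (pderiv timeDir fun t x => φ (t, x)) := by
  rw [dt, pair_eq_pairL2, lineDeriv_curve]

lemma dt_comp_eq (F : ℝ → L2V) (i : Fin 3) (φ : STTest) :
    dt (comp F i) φ = -pairL2 (fun t => coord i (F t)) (pderiv timeDir fun t x => φ (t, x)) := by
  rw [dt, pair_comp_eq_pairL2, lineDeriv_curve]

lemma dx_comp_eq (F : ℝ → L2V) (i k : Fin 3) (φ : STTest) :
    dx k (comp F i) φ
      = -pairL2 (fun t => coord i (F t)) (pderiv (spaceDir k) fun t x => φ (t, x)) := by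
  rw [dx, pair_comp_eq_pairL2, lineDeriv_curve]

/-- Test curves of compact support in time. -/
structure IsSTCurve (F : ℝ → Space → ℝ) : Prop extends IsTestCurve F where
  vanish : ∃ T : ℝ, ∀ t x, T < |t| → F t x = 0

lemma STTest.isSTCurve (φ : STTest) : IsSTCurve fun t x => φ (t, x) where
  toIsTestCurve := STTest.isTestCurve φ
  vanish := by
    obtain ⟨R, hR⟩ := exists_norm_bound_of_hasCompactSupport φ.hasCompactSupport
    exact ⟨R, fun t x ht => hR _ (ht.trans_le (by simp [Prod.norm_def]))⟩

lemma STTest.isSTCurve_pderiv (φ : STTest) (v : ℝ × Space) :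
    IsSTCurve (pderiv v fun t x => φ (t, x)) := by
  rw [← lineDeriv_curve]
  exact STTest.isSTCurve _

lemma integrable_pairL2 {f : ℝ → L2} (hf : Continuous f) {F : ℝ → Space → ℝ} (hF : IsSTCurve F) :
    Integrable fun t => inner ℝ (f t) (toL2 (F t)) := by
  refine (hf.inner hF.continuous_toL2).integrable_of_hasCompactSupport ?_
  obtain ⟨T, hT⟩ := hF.vanish
  refine HasCompactSupport.intro (isCompact_closedBall (0 : ℝ) T) fun t ht => ?_
  have h0 : F t = fun _ => 0 := funext fun x => hT t x (by simpa using ht)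
  rw [h0, toL2_zero, inner_zero_right]

lemma pairL2_smul (a : ℝ) (f : ℝ → L2) (F : ℝ → Space → ℝ) :
    pairL2 (fun t => a • f t) F = a * pairL2 f F := by
  simp only [pairL2, inner_smul_left, RCLike.conj_to_real, integral_const_mul]

lemma pairL2_zero (F : ℝ → Space → ℝ) : pairL2 (fun _ => 0) F = 0 := by
  simp [pairL2]

lemma pairL2_sum {κ : Type*} (s : Finset κ) {f : κ → ℝ → L2} (hf : ∀ k, Continuous (f k))
    {F : ℝ → Space → ℝ} (hF : IsSTCurve F) :
    pairL2 (fun t => ∑ k ∈ s, f k t) F = ∑ k ∈ s, pairL2 (f k) F := by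
  simp only [pairL2, sum_inner]
  exact integral_finsetSum _ fun k _ => integrable_pairL2 (hf k) hF

lemma integral_lawForm {f r : ℝ → L2} {g : Fin 3 → ℝ → L2} (hf : Continuous f)
    (hg : ∀ i, Continuous (g i)) (hr : Continuous r) (φ : STTest) :
    ∫ t, lawForm f g r (fun t x => φ (t, x)) t =
      pairL2 f (pderiv timeDir fun t x => φ (t, x))
        + ∑ i, pairL2 (g i) (pderiv (spaceDir i) fun t x => φ (t, x))
        + pairL2 r fun t x => φ (t, x) := by
  have i1 := integrable_pairL2 hf (STTest.isSTCurve_pderiv φ timeDir)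
  have i2 (i : Fin 3) := integrable_pairL2 (hg i) (STTest.isSTCurve_pderiv φ (spaceDir i))
  have i3 := integrable_pairL2 hr (STTest.isSTCurve φ)
  have i2' := integrable_finsetSum Finset.univ fun i _ => i2 i
  unfold lawForm pairL2
  rw [integral_add, integral_add i1 i2', integral_finsetSum _ fun i _ => i2 i]
  exacts [i1.add i2', i3]

lemma chargeContinuity_iff {ρ : ℝ → L2} {j : ℝ → L2V} (hρ : Continuous ρ) (hj : Continuous j) :
    ChargeContinuity ρ j ↔ IsLaw ρ (fun i t => coord i (j t)) fun _ => 0 := by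
  refine forall_congr' fun φ => ?_
  have hj' (i : Fin 3) : Continuous fun t => coord i (j t) := (coord i).continuous.comp hj
  rw [integral_lawForm hρ hj' continuous_const, pairL2_zero,
    dt_eq, divST]
  simp only [dx_comp_eq, Finset.sum_neg_distrib]
  constructor <;> intro h <;> linarith

/-- The state with the electromagnetic field `u` and vanishing auxiliary fields. -/
def state (u : L2V × L2V) : H Idx :=
  WithLp.toLp 2 (Sum.elim (Sum.elim (fun i => coord i u.1) fun i => coord i u.2) 0)

/-- The source of the Maxwell system. -/
def source (c : ℝ) (ρ : L2) (j : L2V) : H Idx :=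
  WithLp.toLp 2 (Sum.elim (Sum.elim (fun i => (-(4 * Real.pi)) • coord i j) 0)
    (Sum.elim (fun _ => (4 * Real.pi * c) • ρ) 0))

lemma continuous_state {u : ℝ → L2V × L2V} (hu : Continuous u) :
    Continuous fun t => state (u t) := by
  refine (PiLp.continuous_toLp 2 _).comp (continuous_pi fun k => ?_)
  rcases k with (k | k) | (k | k)
  · exact (coord k).continuous.comp hu.fst
  · exact (coord k).continuous.comp hu.snd
  · exact continuous_const
  · exact continuous_const

lemma continuous_source (c : ℝ) {ρ : ℝ → L2} {j : ℝ → L2V} (hρ : Continuous ρ)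
    (hj : Continuous j) : Continuous fun t => source c (ρ t) (j t) := by
  refine (PiLp.continuous_toLp 2 _).comp (continuous_pi fun k => ?_)
  rcases k with (k | k) | (k | k)
  · exact ((coord k).continuous.comp hj).const_smul (-(4 * Real.pi))
  · exact continuous_const
  · exact hρ.const_smul (4 * Real.pi * c)
  · exact continuous_const

lemma state_injective {u v : L2V × L2V} (h : state u = state v) : u = v := by
  have h1 (k : Idx) : state u k = state v k := by rw [h]
  exact Prod.ext (ext_coord fun i => h1 (Sum.inl (Sum.inl i)))
    (ext_coord fun i => h1 (Sum.inl (Sum.inr i)))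

lemma norm_sq_state (u : L2V × L2V) : ‖state u‖ ^ 2 = ∫ x, (‖u.1 x‖ ^ 2 + ‖u.2 x‖ ^ 2) := by
  rw [integral_add (integrable_norm_sq _) (integrable_norm_sq _), ← sum_norm_sq_coord,
    ← sum_norm_sq_coord, PiLp.norm_sq_eq_of_L2]
  simp [Fintype.sum_sum_type, state]

lemma pairL2_flux {V : ℝ → H Idx} (hV : Continuous V) (c : ℝ) (k : Idx) (i : Fin 3)
    {F : ℝ → Space → ℝ} (hF : IsSTCurve F) :
    pairL2 (flux maxwellMat c V k i) F
      = -c * ∑ l, maxwellMat i k l * pairL2 (fun t => V t l) F := by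
  have h : flux maxwellMat c V k i = fun t => (-c) • ∑ l, maxwellMat i k l • V t l := rfl
  have h1 (l : Idx) : Continuous fun t => maxwellMat i k l • V t l :=
    (continuous_coord hV l).const_smul (maxwellMat i k l)
  rw [h, pairL2_smul, pairL2_sum _ h1 hF]
  simp only [pairL2_smul]

lemma maxwellMat_apply (i : Fin 3) (k l : Idx) : maxwellMat i k l = (maxwellCoeff i k l : ℝ) := rfl

/-- The Maxwell equations are the first order system with vanishing auxiliary fields. -/
lemma equations_iff {c : ℝ} (hc : 0 < c) {ρ : ℝ → L2} {j : ℝ → L2V} {u : ℝ → L2V × L2V}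
    (hρ : Continuous ρ) (hj : Continuous j) (hu : Continuous u) :
    Equations c ρ j (fun t => (u t).1) (fun t => (u t).2) ↔
      IsWeakSolution maxwellMat c (fun t => state (u t)) fun t => source c (ρ t) (j t) := by
  have hV := continuous_state hu
  have hS := continuous_source c hρ hj
  -- An opaque name for the weak forms, so that simplification rewrites only their expanded side.
  obtain ⟨W, hW⟩ : ∃ W : Idx → STTest → ℝ, ∀ k φ, W k φ = ∫ t, lawForm (fun t => state (u t) k)
      (flux maxwellMat c (fun t => state (u t)) k) (fun t => source c (ρ t) (j t) k)
      (fun t x => φ (t, x)) t := ⟨_, fun _ _ => rfl⟩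
  have hiff : IsWeakSolution maxwellMat c (fun t => state (u t))
      (fun t => source c (ρ t) (j t)) ↔ ∀ k φ, W k φ = 0 := by
    simp only [hW]; rfl
  rw [hiff]
  have key (k : Idx) (φ : STTest) := (hW k φ).trans (integral_lawForm (continuous_coord hV k)
    (continuous_flux (A := maxwellMat) hV c k) (continuous_coord hS k) φ)
  simp only [pairL2_flux hV c _ _ (STTest.isSTCurve_pderiv _ _), Fintype.sum_sum_type] at key
  have hE (k : Fin 3) (φ : STTest) := key (Sum.inl (Sum.inl k)) φ
  have hB (k : Fin 3) (φ : STTest) := key (Sum.inl (Sum.inr k)) φ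
  have hf (φ : STTest) := key (Sum.inr (Sum.inl ())) φ
  have hg (φ : STTest) := key (Sum.inr (Sum.inr ())) φ
  simp only [state, source, Sum.elim_inl, Sum.elim_inr, pairL2_zero, pairL2_smul, Pi.zero_apply,
    maxwellMat_apply, maxwellCoeff, Matrix.fromBlocks_apply₁₁, Matrix.fromBlocks_apply₁₂,
    Matrix.fromBlocks_apply₂₁, Matrix.fromBlocks_apply₂₂, Matrix.of_apply, Matrix.zero_apply,
    Int.cast_zero, zero_mul, mul_zero, Finset.sum_const_zero, add_zero, zero_add] at hE hB hf hg
  -- With f = g = 0, the E and B rows are the two curl equations times `c` and `-c`, and the f and g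
  -- rows the two divergence equations times `-c`. As `c ≠ 0`, both directions follow.
  have hE' (k : Fin 3) (φ : STTest) : W (Sum.inl (Sum.inl k)) φ
      = c * (rotST (fun t => (u t).2) k φ - (4 * Real.pi / c * pair (comp j k) φ
        + 1 / c * dt (comp (fun t => (u t).1) k) φ)) := by
    rw [hE]
    simp only [rotST, dx_comp_eq, dt_comp_eq, pair_comp_eq_pairL2]
    field_simp
    fin_cases k <;> simp [levi, Fin.sum_univ_three] <;> ring
  have hB' (k : Fin 3) (φ : STTest) : W (Sum.inl (Sum.inr k)) φ
      = -c * (rotST (fun t => (u t).1) k φ + (1 / c) * dt (comp (fun t => (u t).2) k) φ) := by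
    rw [hB]
    simp only [rotST, dx_comp_eq, dt_comp_eq]
    field_simp
    fin_cases k <;> simp [levi, Fin.sum_univ_three] <;> ring
  have hf' (φ : STTest) : W (Sum.inr (Sum.inl ())) φ
      = -c * (divST (fun t => (u t).1) φ - 4 * Real.pi * pair (fun t => ρ t) φ) := by
    rw [hf]
    simp only [divST, dx_comp_eq, pair_eq_pairL2]
    simp [Fin.sum_univ_three]
    ring
  have hg' (φ : STTest) : W (Sum.inr (Sum.inr ())) φ = -c * divST (fun t => (u t).2) φ := by
    rw [hg]
    simp only [divST, dx_comp_eq]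
    simp [Fin.sum_univ_three]
    ring
  constructor
  · rintro ⟨h1, h2, h3, h4⟩ ((k | k) | (k | k)) φ
    · rw [hE', h4 k φ]; ring
    · rw [hB', h2 k φ]; ring
    · rw [hf', h1 φ]; ring
    · rw [hg', h3 φ]; ring
  · intro h
    refine ⟨fun φ => ?_, fun k φ => ?_, fun φ => ?_, fun k φ => ?_⟩
    · have := h (Sum.inr (Sum.inl ())) φ
      rw [hf', mul_eq_zero] at this
      exact sub_eq_zero.1 (this.resolve_left (neg_ne_zero.2 hc.ne'))
    · have := h (Sum.inl (Sum.inr k)) φ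
      rw [hB', mul_eq_zero] at this
      have h0 := this.resolve_left (neg_ne_zero.2 hc.ne')
      linarith
    · have := h (Sum.inr (Sum.inr ())) φ
      rw [hg', mul_eq_zero] at this
      exact this.resolve_left (neg_ne_zero.2 hc.ne')
    · have := h (Sum.inl (Sum.inl k)) φ
      rw [hE', mul_eq_zero] at this
      exact sub_eq_zero.1 (this.resolve_left hc.ne')

section

/-! ### The Kirchhoff kernel -/

lemma integral_surfaceMeasure (r : ℝ) (φ : Test) :
    ∫ x, φ x ∂surfaceMeasure r = r ^ 2 * ∫ y, φ (r • y) ∂sphereMeasure := by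
  have h1 : ∫ y, φ (r • y) ∂sphereMeasure = ∫ z : Metric.sphere (0 : Space) 1,
      φ (r • (z : Space)) ∂(volume : Measure Space).toSphere := by
    rw [sphereMeasure, integral_map measurable_subtype_coe.aemeasurable]
    exact (φ.continuous.comp (by fun_prop)).aestronglyMeasurable
  rw [surfaceMeasure, integral_smul_measure, integral_map
    (by fun_prop) φ.continuous.aestronglyMeasurable, h1, ENNReal.toReal_ofReal (sq_nonneg r),
    smul_eq_mul]

/-- The area factor `t²` against `1/t` leaves `t`, and antipodal symmetry replaces `|t|` by `t`. At
`t = 0` both sides are 0, since the inverse of 0 is 0. -/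
lemma K_apply (t : ℝ) (φ : Test) : K t φ = kirchhoff φ t 0 := by
  have h0 : K t φ = (4 * Real.pi * t)⁻¹ * ∫ x, φ x ∂surfaceMeasure |t| := rfl
  have h1 : ∫ y, φ (|t| • y) ∂sphereMeasure = ∫ y, φ (t • y) ∂sphereMeasure := by
    rcases abs_choice t with h | h
    · rw [h]
    · rw [h, ← integral_sphereMeasure_neg]
      simp
  rw [h0, integral_surfaceMeasure, h1, sq_abs, kirchhoff]
  simp only [zero_add]
  rcases eq_or_ne t 0 with rfl | ht
  · simp
  · field_simp

lemma kirchhoff_shift (y : Space) (φ : Test) : kirchhoff (shift y φ) = fun t x =>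
    kirchhoff φ t (x + y) := by
  funext t x
  have h (z : Space) : shift y φ (x + t • z) = φ (x + y + t • z) :=
    congrArg φ (add_right_comm x (t • z) y)
  simp only [kirchhoff, h]

/-- Hence convolving `f` with `K t` and pairing with `φ` means integrating `f` against the Kirchhoff
solution with datum `φ`. -/
lemma K_shift (t : ℝ) (y : Space) (φ : Test) : K t (shift y φ) = kirchhoff φ t y := by
  rw [K_apply, kirchhoff_shift]
  simp only [zero_add]

lemma lineDeriv_shift (v y : Space) (φ : Test) : ∂_{v} (shift y φ) = shift y (∂_{v} φ) := by
  ext x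
  rw [test_lineDeriv_apply]
  change fderiv ℝ (fun x => φ (x + y)) x v = (∂_{v} φ) (x + y)
  rw [fderiv_comp_add_right, test_lineDeriv_apply]

lemma lineDeriv_K_shift (t : ℝ) (v y : Space) (φ : Test) :
    (∂_{v} (K t)) (shift y φ) = -kirchhoff (∂_{v} φ) t y := by
  rw [Distribution.lineDerivOp_apply_apply, map_neg, lineDeriv_shift, K_shift]

lemma continuous_integral_test (μ : Measure Space) [IsFiniteMeasure μ] {w : Space → ℝ}
    (hw : Continuous w) : Continuous fun φ : Test => ∫ x, φ x * w x ∂μ := by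
  have h : LocallyIntegrableOn w ((⊤ : Opens Space) : Set Space) μ :=
    hw.locallyIntegrable.locallyIntegrableOn _
  refine (TestFunction.integralAgainstBilinCLM (n := ⊤) (Ω := (⊤ : Opens Space))
    (ContinuousLinearMap.mul ℝ ℝ) μ w).continuous.congr fun φ => ?_
  rw [TestFunction.integralAgainstBilinCLM_eq_integral h]
  simp

/-- Writing the derivative through finite measures applied to `φ` and `∂ᵢφ` makes its continuity in
`φ` visible, as `kirchhoffDeriv` requires. -/
lemma pderiv_time_kirchhoff_eq_integral (t : ℝ) (φ : Test) :
    pderiv timeDir (kirchhoff φ) t 0 =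
      1 / (4 * Real.pi) * ∫ z, φ z * 1 ∂(sphereMeasure.map fun y => t • y)
      + 1 / (4 * Real.pi) *
        ∑ i, ∫ z, (∂_{e i} φ) z * z i ∂(sphereMeasure.map fun y => t • y) := by
  have hm : AEMeasurable (fun y : Space => t • y) sphereMeasure := by fun_prop
  have h1 (i : Fin 3) : ∫ z, (∂_{e i} φ) z * z i ∂(sphereMeasure.map fun y => t • y)
      = t * ∫ y, y i * (∂_{e i} φ) (t • y) ∂sphereMeasure := by
    rw [integral_map hm, ← integral_const_mul]
    · refine integral_congr_ae (Filter.Eventually.of_forall fun y => ?_)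
      simp only [PiLp.smul_apply, smul_eq_mul]
      ring
    · exact ((∂_{e i} φ).continuous.mul (by fun_prop)).aestronglyMeasurable
  rw [pderiv_time_kirchhoff]
  simp only [h1, mul_one, zero_add]
  rw [integral_map hm φ.continuous.aestronglyMeasurable, ← Finset.mul_sum]
  ring

/-- The time derivative of the Kirchhoff kernel. -/
def kirchhoffDeriv (t : ℝ) : Dist where
  toFun φ := pderiv timeDir (kirchhoff φ) t 0
  map_add' φ ψ := by
    have h : kirchhoff (φ + ψ) = fun t x => kirchhoff φ t x + kirchhoff ψ t x := by
      funext t x; exact kirchhoff_add φ ψ t x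
    rw [h, pderiv_add (kirchhoff_isTestCurve _) (kirchhoff_isTestCurve _)]
  map_smul' a φ := by
    have h : kirchhoff (a • φ) = fun t x => a * kirchhoff φ t x := by
      funext t x; exact kirchhoff_smul a φ t x
    rw [h, pderiv_const_mul (kirchhoff_isTestCurve _)]
    rfl
  cont := by
    simp only [pderiv_time_kirchhoff_eq_integral]
    refine (continuous_const.mul (continuous_integral_test _ continuous_const)).add
      (continuous_const.mul (continuous_finsetSum _ fun i _ => ?_))
    exact (continuous_integral_test (sphereMeasure.map fun y => t • y)
      (w := fun z => z i) (by fun_prop)).comp (LineDeriv.continuous_lineDerivOp (e i))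

/-- `timeDeriv` is defined by choice; `kirchhoffDeriv` shows that a derivative exists, and
uniqueness of derivatives identifies the choice. -/
lemma timeDeriv_K_eq (t : ℝ) (φ : Test) : timeDeriv K t φ = pderiv timeDir (kirchhoff φ) t 0 := by
  have hD (φ : Test) : HasDerivAt (fun τ => K τ φ) (kirchhoffDeriv t φ) t := by
    simp only [K_apply]
    exact (kirchhoff_isTestCurve φ).hasDerivAt_time t 0
  have h : ∃ D : Dist, ∀ φ : Test, HasDerivAt (fun τ => K τ φ) (D φ) t := ⟨_, hD⟩
  rw [timeDeriv, dif_pos h]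
  exact (h.choose_spec φ).unique (hD φ)

lemma hasDerivAt_K (t : ℝ) (φ : Test) : HasDerivAt (fun τ => K τ φ) (timeDeriv K t φ) t := by
  rw [timeDeriv_K_eq]
  simp only [K_apply]
  exact (kirchhoff_isTestCurve φ).hasDerivAt_time t 0

lemma timeDeriv_K_shift (t : ℝ) (y : Space) (φ : Test) :
    timeDeriv K t (shift y φ) = pderiv timeDir (kirchhoff φ) t y := by
  have h := hasDerivAt_K t (shift y φ)
  simp only [K_shift] at h
  exact h.unique ((kirchhoff_isTestCurve φ).hasDerivAt_time t y)

/-! ### Huygens' principle -/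

lemma integral_eq_zero_of_vanish {t : ℝ} {φ : Test}
    (hφ : tsupport φ ⊆ (Metric.sphere (0 : Space) |t|)ᶜ) (w : Space → ℝ) :
    ∫ y, w y * φ (0 + t • y) ∂sphereMeasure = 0 := by
  refine integral_eq_zero_of_ae ?_
  filter_upwards [ae_norm_eq_one] with y hy
  have h : φ (0 + t • y) = 0 := by
    refine image_eq_zero_of_notMem_tsupport fun hmem => hφ hmem ?_
    simp [norm_smul, hy]
  rw [h, mul_zero, Pi.zero_apply]

lemma tsupport_lineDeriv_subset (v : Space) (φ : Test) : tsupport (∂_{v} φ : Test) ⊆ tsupport φ := by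
  refine closure_minimal (fun x hx => ?_) (isClosed_tsupport _)
  by_contra h
  refine hx ?_
  rw [test_lineDeriv_apply]
  have : fderiv ℝ φ x = 0 := image_eq_zero_of_notMem_tsupport fun h' =>
    h (tsupport_fderiv_subset ℝ h')
  rw [this]; rfl

lemma K_isVanishingOn (t : ℝ) :
    Distribution.IsVanishingOn (K t) (Metric.sphere (0 : Space) |t|)ᶜ := by
  intro φ hφ
  have := integral_eq_zero_of_vanish hφ fun _ => 1
  simp only [one_mul] at this
  rw [K_apply, kirchhoff, this, mul_zero]

lemma lineDeriv_K_isVanishingOn (t : ℝ) (v : Space) :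
    Distribution.IsVanishingOn (∂_{v} (K t) : Dist) (Metric.sphere (0 : Space) |t|)ᶜ := by
  intro φ hφ
  rw [Distribution.lineDerivOp_apply_apply, map_neg,
    K_isVanishingOn t _ ((tsupport_lineDeriv_subset v φ).trans hφ), neg_zero]

/-- The formula for ∂ₜK involves only `φ` and its first derivatives on the sphere, and derivatives
do not enlarge supports. -/
lemma timeDeriv_K_isVanishingOn (t : ℝ) :
    Distribution.IsVanishingOn (timeDeriv K t) (Metric.sphere (0 : Space) |t|)ᶜ := by
  intro φ hφ
  have h1 := integral_eq_zero_of_vanish hφ fun _ => 1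
  have h2 (i : Fin 3) := integral_eq_zero_of_vanish
    ((tsupport_lineDeriv_subset (e i) φ).trans hφ) fun y => y i
  simp only [one_mul] at h1
  rw [timeDeriv_K_eq, pderiv_time_kirchhoff, h1]
  simp only [h2, Finset.sum_const_zero, mul_zero, add_zero]

/-! ### Vanishing sets of matrix entries -/

section vanishing

variable {s : Set Space}

lemma isVanishingOn_zero : Distribution.IsVanishingOn (0 : Dist) s := fun _ _ => rfl

lemma isVanishingOn_neg {T : Dist} (h : Distribution.IsVanishingOn T s) :
    Distribution.IsVanishingOn (-T : Dist) s := fun φ hφ => by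
  change -(T φ) = 0
  rw [h φ hφ, neg_zero]

lemma isVanishingOn_smul {T : Dist} (h : Distribution.IsVanishingOn T s) (a : ℝ) :
    Distribution.IsVanishingOn (a • T : Dist) s := fun φ hφ => by
  change a • (T φ) = 0
  rw [h φ hφ, smul_zero]

lemma isVanishingOn_diagonal {T : Dist} (h : Distribution.IsVanishingOn T s) (i k : Fin 3) :
    Distribution.IsVanishingOn (Matrix.diagonal (fun _ => T) i k : Dist) s := by
  rw [Matrix.diagonal_apply]
  split_ifs
  · exact h
  · exact isVanishingOn_zero

lemma isVanishingOn_rotMat {T : Dist}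
    (h : ∀ v : Space, Distribution.IsVanishingOn (∂_{v} T : Dist) s) (i k : Fin 3) :
    Distribution.IsVanishingOn (rotMat T i k) s := by
  fin_cases i <;> fin_cases k <;>
    first
    | exact isVanishingOn_zero
    | exact h _
    | exact isVanishingOn_neg (h _)

end vanishing

lemma M_isVanishingOn {c : ℝ} (hc : 0 < c) (t : ℝ) (i k : Fin 3 ⊕ Fin 3) :
    Distribution.IsVanishingOn (M c t i k) (Metric.sphere (0 : Space) (c * |t|))ᶜ := by
  have hr : c * |t| = |c * t| := by rw [abs_mul, abs_of_pos hc]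
  rw [hr]
  have h1 := timeDeriv_K_isVanishingOn (c * t)
  have h2 := lineDeriv_K_isVanishingOn (c * t)
  rcases i with i | i <;> rcases k with k | k
  · exact isVanishingOn_diagonal h1 i k
  · exact isVanishingOn_rotMat h2 i k
  · exact isVanishingOn_neg (isVanishingOn_rotMat h2 i k)
  · exact isVanishingOn_diagonal h1 i k

lemma G_isVanishingOn {c : ℝ} (hc : 0 < c) (t : ℝ) (i : Fin 3 ⊕ Fin 3) (k : Unit ⊕ Fin 3) :
    Distribution.IsVanishingOn (G c t i k) (Metric.sphere (0 : Space) (c * |t|))ᶜ := by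
  have hr : c * |t| = |c * t| := by rw [abs_mul, abs_of_pos hc]
  rw [hr]
  have h1 := timeDeriv_K_isVanishingOn (c * t)
  have h2 := lineDeriv_K_isVanishingOn (c * t)
  rcases i with i | i <;> rcases k with k | k
  · exact isVanishingOn_smul (isVanishingOn_neg (h2 _)) c
  · exact isVanishingOn_smul (isVanishingOn_neg (isVanishingOn_diagonal h1 i k)) c
  · exact isVanishingOn_smul isVanishingOn_zero c
  · exact isVanishingOn_smul (isVanishingOn_rotMat h2 i k) c

end

/-! ### The convolution representation -/

lemma kirchhoff_zero_test (t : ℝ) (x : Space) : kirchhoff 0 t x = 0 := by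
  simpa using kirchhoff_smul 0 0 t x

lemma flow_single {ι : Type} [Fintype ι] [DecidableEq ι] (A : Fin 3 → Matrix ι ι ℝ) (c : ℝ)
    (k l : ι) (φ : Test) (t : ℝ) (x : Space) :
    flow A c (Pi.single k φ) l t x =
      (if l = k then pderiv timeDir (kirchhoff φ) (c * t) x else 0)
        + ∑ i, A i l k * kirchhoff (∂_{e i} φ) (c * t) x := by
  have h0 : kirchhoff 0 = fun _ _ => 0 := by
    funext t x; exact kirchhoff_zero_test t x
  unfold flow
  congr 1
  · split_ifs with h
    · rw [h, Pi.single_eq_same]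
    · rw [Pi.single_eq_of_ne h, h0]
      simp [pderiv]
  · refine Finset.sum_congr rfl fun i _ => ?_
    rw [Finset.sum_eq_single k]
    · rw [Pi.single_eq_same]
    · intro m _ hm
      rw [Pi.single_eq_of_ne hm, LineDeriv.lineDerivOp_zero, kirchhoff_zero_test, mul_zero]
    · simp

lemma isTestCurve_flow_memLp (c t : ℝ) (Φ : Idx → Test) (k : Idx) :
    MemLp (flow maxwellMat c Φ k t) 2 volume := (isTestCurve_flow c Φ k).memLp t

lemma rotMat_K_shift (t : ℝ) (y : Space) (φ : Test) (i k : Fin 3) :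
    rotMat (K t) i k (shift y φ) = -∑ l, (levi i l k : ℝ) * kirchhoff (∂_{e l} φ) t y := by
  fin_cases i <;> fin_cases k <;>
    simp [rotMat, levi, lineDeriv_shift, K_shift]

lemma diagonal_shift (t : ℝ) (y : Space) (φ : Test) (i k : Fin 3) :
    Matrix.diagonal (fun _ => timeDeriv K t) i k (shift y φ)
      = if i = k then pderiv timeDir (kirchhoff φ) t y else 0 := by
  rw [Matrix.diagonal_apply]
  split_ifs
  · exact timeDeriv_K_shift t y φ
  · rfl

/-- The convolution acts on the test function through the adjoint of the propagator, which is the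
propagator at `-t`. Parity of K and ∂ₜK and symmetry of the coefficients match the signs. -/
lemma M_shift (c t : ℝ) (y : Space) (φ : Test) (k l : Fin 3 ⊕ Fin 3) :
    M c t k l (shift y φ)
      = flow maxwellMat c (Pi.single (Sum.inl k) φ) (Sum.inl l) (-t) y := by
  rw [flow_single]
  simp only [mul_neg, pderiv_time_kirchhoff_neg, kirchhoff_neg]
  rcases k with k | k <;> rcases l with l | l
  · refine (diagonal_shift (c * t) y φ k l).trans ?_
    simp [maxwellMat_apply, maxwellCoeff, eq_comm]
  · refine (rotMat_K_shift (c * t) y φ k l).trans ?_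
    simp only [isClifford_maxwellMat.symm _ (Sum.inl (Sum.inr l))]
    simp [maxwellMat_apply, maxwellCoeff]
  · refine (congrArg Neg.neg (rotMat_K_shift (c * t) y φ k l)).trans ?_
    simp only [isClifford_maxwellMat.symm _ (Sum.inl (Sum.inl l))]
    simp [maxwellMat_apply, maxwellCoeff]
  · refine (diagonal_shift (c * t) y φ k l).trans ?_
    simp [maxwellMat_apply, maxwellCoeff, eq_comm]

/-- Charge enters through the f row as `4πcρ`, so its column of `G` is `c` times a propagator
column. -/
lemma G_shift_charge (c t : ℝ) (y : Space) (φ : Test) (k : Fin 3 ⊕ Fin 3) :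
    G c t k (Sum.inl ()) (shift y φ)
      = c * flow maxwellMat c (Pi.single (Sum.inl k) φ) (Sum.inr (Sum.inl ())) (-t) y := by
  rw [flow_single]
  simp only [mul_neg, pderiv_time_kirchhoff_neg, kirchhoff_neg]
  rcases k with k | k
  · refine (congrArg (fun a => c * -a) (lineDeriv_K_shift (c * t) (e k) y φ)).trans ?_
    simp [maxwellMat_apply, maxwellCoeff]
  · refine (mul_zero c).trans ?_
    simp [maxwellMat_apply, maxwellCoeff]

/-- The current enters only the E rows, as `-4πj = 4π(-c)(j/c)`; this is the factor `-c`. -/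
lemma G_shift_current (c t : ℝ) (y : Space) (φ : Test) (k : Fin 3 ⊕ Fin 3) (l : Fin 3) :
    G c t k (Sum.inr l) (shift y φ)
      = -c * flow maxwellMat c (Pi.single (Sum.inl k) φ) (Sum.inl (Sum.inl l)) (-t) y := by
  rw [← M_shift]
  rcases k with k | k
  · refine (mul_neg c _).trans ?_
    rw [neg_mul]; rfl
  · change c * rotMat (K (c * t)) k l (shift y φ) = -c * -(rotMat (K (c * t)) k l (shift y φ))
    ring

lemma inner_state_toH (u : L2V × L2V) {f : Idx → Space → ℝ} (hf : ∀ k, MemLp (f k) 2 volume) :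
    inner ℝ (state u) (toH f) = ∑ k, ∫ x, fieldVec u k x * f (Sum.inl k) x := by
  rw [inner_toH, Fintype.sum_sum_type, Fintype.sum_sum_type, Fintype.sum_sum_type]
  have h1 (k : Fin 3) : inner ℝ (state u (Sum.inl (Sum.inl k))) (toL2 (f (Sum.inl (Sum.inl k))))
      = ∫ x, fieldVec u (Sum.inl k) x * f (Sum.inl (Sum.inl k)) x := inner_coord k u.1 (hf _)
  have h2 (k : Fin 3) : inner ℝ (state u (Sum.inl (Sum.inr k))) (toL2 (f (Sum.inl (Sum.inr k))))
      = ∫ x, fieldVec u (Sum.inr k) x * f (Sum.inl (Sum.inr k)) x := inner_coord k u.2 (hf _)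
  simp only [h1, h2]
  simp [state]

lemma matConv_M (c t : ℝ) (u : L2V × L2V) (k : Fin 3 ⊕ Fin 3) (φ : Test) :
    matConv (M c t) (fieldVec u) k φ
      = inner ℝ (state u) (toH fun l => flow maxwellMat c (Pi.single (Sum.inl k) φ) l (-t)) := by
  rw [inner_state_toH _ fun l => isTestCurve_flow_memLp c (-t) _ l]
  simp only [matConv, conv, M_shift]

lemma matConv_G {c : ℝ} (hc : 0 < c) (t : ℝ) (ρ : L2) (j : L2V) (k : Fin 3 ⊕ Fin 3) (φ : Test) :
    4 * Real.pi * matConv (G c t) (sourceVec c ρ j) k φ = inner ℝ (source c ρ j)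
      (toH fun l => flow maxwellMat c (Pi.single (Sum.inl k) φ) l (-t)) := by
  have hf := isTestCurve_flow_memLp c (-t) (Pi.single (Sum.inl k) φ)
  have h1 : ∫ y, ρ y * (c * flow maxwellMat c (Pi.single (Sum.inl k) φ) (Sum.inr (Sum.inl ()))
      (-t) y) = c * inner ℝ ρ (toL2 (flow maxwellMat c (Pi.single (Sum.inl k) φ)
        (Sum.inr (Sum.inl ())) (-t))) := by
    rw [inner_toL2 _ (hf _), ← integral_const_mul]
    exact integral_congr_ae (Filter.Eventually.of_forall fun y => by ring)
  have h2 (l : Fin 3) : ∫ y, 1 / c * j y l * (-c * flow maxwellMat c (Pi.single (Sum.inl k) φ)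
      (Sum.inl (Sum.inl l)) (-t) y) = -inner ℝ (coord l j) (toL2 (flow maxwellMat c
        (Pi.single (Sum.inl k) φ) (Sum.inl (Sum.inl l)) (-t))) := by
    rw [inner_coord _ _ (hf _), ← integral_neg]
    refine integral_congr_ae (Filter.Eventually.of_forall fun y => ?_)
    simp only
    field_simp
  rw [inner_toH]
  simp only [Fintype.sum_sum_type, matConv, conv, sourceVec, Sum.elim_inl, Sum.elim_inr,
    Finset.univ_unique, Finset.sum_singleton, PUnit.default_eq_unit, G_shift_charge,
    G_shift_current, h1, h2, source, Pi.zero_apply, inner_zero_left, Finset.sum_const_zero,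
    inner_smul_left, RCLike.conj_to_real, add_zero, ← Finset.mul_sum, Finset.sum_neg_distrib]
  ring

/-! ### The auxiliary fields vanish -/

lemma HasDiv.sum_inner {F : L2V} {f : Space → ℝ} (h : HasDiv F f) (φ : Test) :
    ∑ i, inner ℝ (coord i F) (toL2 (∂_{e i} φ : Test)) = -∫ x, f x * φ x := by
  rw [← h φ, neg_neg]
  exact Finset.sum_congr rfl fun i _ => inner_coord i F (memLp_test _)

lemma flow_charge (c t : ℝ) (ψ : Test) (k : Fin 3) :
    flow maxwellMat c (Pi.single (Sum.inr (Sum.inl ())) ψ) (Sum.inl (Sum.inl k)) t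
      = fun x => (-1) * kirchhoff (∂_{e k} ψ) (c * t) x := by
  funext x
  rw [flow_single]
  simp [maxwellMat_apply, maxwellCoeff]

lemma toL2_kirchhoff_slice (ψ : Test) (t : ℝ) (k : Fin 3) :
    toL2 (kirchhoff (∂_{e k} ψ) t) = toL2 (∂_{e k} ((kirchhoff_isTestCurve ψ).slice t) : Test) := by
  congr 1
  funext x
  rw [← pderiv_space_kirchhoff, (kirchhoff_isTestCurve ψ).pderiv_space, test_lineDeriv_apply]
  rfl

section

lemma inner_state_flow_charge (c t : ℝ) (u : L2V × L2V) (ψ : Test) :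
    inner ℝ (state u) (toH fun l => flow maxwellMat c (Pi.single (Sum.inr (Sum.inl ())) ψ) l t)
      = -∑ k, inner ℝ (coord k u.1) (toL2 (kirchhoff (∂_{e k} ψ) (c * t))) := by
  have hB (k : Fin 3) : flow maxwellMat c (Pi.single (Sum.inr (Sum.inl ())) ψ)
      (Sum.inl (Sum.inr k)) t = fun _ => 0 := by
    funext x
    rw [flow_single]
    simp [maxwellMat_apply, maxwellCoeff]
  have hE (k : Fin 3) : toL2 (flow maxwellMat c (Pi.single (Sum.inr (Sum.inl ())) ψ)
      (Sum.inl (Sum.inl k)) t) = (-1 : ℝ) • toL2 (kirchhoff (∂_{e k} ψ) (c * t)) := by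
    rw [flow_charge, toL2_const_mul ((kirchhoff_isTestCurve _).memLp _)]
  simp only [inner_toH, Fintype.sum_sum_type, hB, hE, toL2_zero, state, inner_zero_right,
    inner_smul_right, Sum.elim_inl, Sum.elim_inr, Pi.zero_apply, inner_zero_left]
  simp

/-- Up to the factor `4π`, the right side is the charge continuity law tested with the Kirchhoff
solution run at speed `c`. -/
lemma inner_source_flow_charge (c t : ℝ) (ρ : L2) (j : L2V) (ψ : Test) :
    inner ℝ (source c ρ j)
        (toH fun l => flow maxwellMat c (Pi.single (Sum.inr (Sum.inl ())) ψ) l t)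
      = 4 * Real.pi * (c * inner ℝ ρ (toL2 (pderiv timeDir (kirchhoff ψ) (c * t)))
        + ∑ k, inner ℝ (coord k j) (toL2 (kirchhoff (∂_{e k} ψ) (c * t)))) := by
  have hf : flow maxwellMat c (Pi.single (Sum.inr (Sum.inl ())) ψ)
      (Sum.inr (Sum.inl ())) t = pderiv timeDir (kirchhoff ψ) (c * t) := by
    funext x
    rw [flow_single]
    simp [maxwellMat_apply, maxwellCoeff]
  have hE (k : Fin 3) : toL2 (flow maxwellMat c (Pi.single (Sum.inr (Sum.inl ())) ψ)
      (Sum.inl (Sum.inl k)) t) = (-1 : ℝ) • toL2 (kirchhoff (∂_{e k} ψ) (c * t)) := by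
    rw [flow_charge, toL2_const_mul ((kirchhoff_isTestCurve _).memLp _)]
  simp only [inner_toH, Fintype.sum_sum_type, hf, hE, source, inner_smul_left, inner_smul_right,
    Sum.elim_inl, Sum.elim_inr, Pi.zero_apply, inner_zero_left, RCLike.conj_to_real,
    Finset.univ_unique, Finset.sum_singleton, PUnit.default_eq_unit, Finset.sum_const_zero,
    ← Finset.mul_sum]
  ring

lemma inner_state_flow_magnetic (c t : ℝ) (u : L2V × L2V) (ψ : Test) :
    inner ℝ (state u) (toH fun l => flow maxwellMat c (Pi.single (Sum.inr (Sum.inr ())) ψ) l t)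
      = -∑ k, inner ℝ (coord k u.2) (toL2 (kirchhoff (∂_{e k} ψ) (c * t))) := by
  have hE (k : Fin 3) : flow maxwellMat c (Pi.single (Sum.inr (Sum.inr ())) ψ)
      (Sum.inl (Sum.inl k)) t = fun _ => 0 := by
    funext x
    rw [flow_single]
    simp [maxwellMat_apply, maxwellCoeff]
  have hB (k : Fin 3) : toL2 (flow maxwellMat c (Pi.single (Sum.inr (Sum.inr ())) ψ)
      (Sum.inl (Sum.inr k)) t) = (-1 : ℝ) • toL2 (kirchhoff (∂_{e k} ψ) (c * t)) := by
    rw [← toL2_const_mul ((kirchhoff_isTestCurve _).memLp _)]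
    congr 1
    funext x
    rw [flow_single]
    simp [maxwellMat_apply, maxwellCoeff]
  simp only [inner_toH, Fintype.sum_sum_type, hB, hE, toL2_zero, state, inner_zero_right,
    inner_smul_right, Sum.elim_inl, Sum.elim_inr, Pi.zero_apply, inner_zero_left]
  simp

lemma inner_source_flow_magnetic (c t : ℝ) (ρ : L2) (j : L2V) (ψ : Test) :
    inner ℝ (source c ρ j)
      (toH fun l => flow maxwellMat c (Pi.single (Sum.inr (Sum.inr ())) ψ) l t) = 0 := by
  have hE (k : Fin 3) : flow maxwellMat c (Pi.single (Sum.inr (Sum.inr ())) ψ)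
      (Sum.inl (Sum.inl k)) t = fun _ => 0 := by
    funext x
    rw [flow_single]
    simp [maxwellMat_apply, maxwellCoeff]
  have hf : flow maxwellMat c (Pi.single (Sum.inr (Sum.inr ())) ψ)
      (Sum.inr (Sum.inl ())) t = fun _ => 0 := by
    funext x
    rw [flow_single]
    simp [maxwellMat_apply, maxwellCoeff]
  simp [inner_toH, Fintype.sum_sum_type, hE, hf, toL2_zero, source]

lemma HasDiv.sum_inner_kirchhoff {F : L2V} {f : Space → ℝ} (h : HasDiv F f) (ψ : Test) (t : ℝ) :
    ∑ k, inner ℝ (coord k F) (toL2 (kirchhoff (∂_{e k} ψ) t))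
      = -∫ x, f x * kirchhoff ψ t x := by
  simp only [toL2_kirchhoff_slice]
  exact h.sum_inner _

/-! ### Vanishing of the auxiliary fields along Duhamel's solution -/

section Cauchy

variable {c : ℝ} {E₀ B₀ : L2V} {ρ : ℝ → L2} {j : ℝ → L2V}

/-- Charge continuity propagates Gauss' law. -/
lemma duhamel_charge_eq_zero (c : ℝ) (hρ : Continuous ρ) (hj : Continuous j)
    (hE₀ : HasDiv E₀ fun x => 4 * Real.pi * ρ 0 x) (hcont : ChargeContinuity ρ j) (t : ℝ) :
    duhamel maxwellMat c (state (E₀, B₀)) (fun s => source c (ρ s) (j s)) t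
      (Sum.inr (Sum.inl ())) = 0 := by
  refine eq_zero_of_inner_test_eq_zero fun ψ => ?_
  have hK := kirchhoff_isTestCurve ψ
  have hF : IsTestCurve fun s => kirchhoff ψ (c * s + -(c * t)) := hK.comp_affine c (-(c * t))
  -- The test curve is the Kirchhoff solution that vanishes at time `t`. The integrated law thus has
  -- no contribution at `t`, and the one at 0 cancels the initial Gauss term.
  have hlaw := ((chargeContinuity_iff hρ hj).1 hcont).inner_sub_inner hρ
    (fun i => (coord i).continuous.comp hj) continuous_const hF 0 t
  have hS := continuous_source c hρ hj
  rw [← inner_testH_single, inner_duhamel_testH isClifford_maxwellMat c _ hS,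
    inner_state_flow_charge, hE₀.sum_inner_kirchhoff]
  simp only [inner_source_flow_charge, intervalIntegral.integral_const_mul]
  have h1 : ∫ x, 4 * Real.pi * ρ 0 x * kirchhoff ψ (c * -t) x
      = 4 * Real.pi * inner ℝ (ρ 0) (toL2 (kirchhoff ψ (c * 0 + -(c * t)))) := by
    rw [inner_toL2 _ (hF.memLp 0), ← integral_const_mul]
    refine integral_congr_ae (Filter.Eventually.of_forall fun x => ?_)
    simp only [mul_zero, zero_add, mul_neg]
    ring
  have h2 : toL2 (kirchhoff ψ (c * t + -(c * t))) = 0 := by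
    rw [← toL2_zero]
    congr 1
    funext x
    rw [add_neg_cancel, kirchhoff_zero]
  have h3 (s : ℝ) : c * (s - t) = c * s + -(c * t) := by ring
  have h4 (s : ℝ) : toL2 (pderiv timeDir (fun s => kirchhoff ψ (c * s + -(c * t))) s)
      = c • toL2 (pderiv timeDir (kirchhoff ψ) (c * s + -(c * t))) := by
    rw [← toL2_const_mul ((hK.pderiv _).memLp _)]
    congr 1
    funext x
    exact pderiv_time_comp_affine hK _ _ _ _
  have h5 (s : ℝ) (i : Fin 3) :
      pderiv (spaceDir i) (fun s => kirchhoff ψ (c * s + -(c * t))) s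
        = kirchhoff (∂_{e i} ψ) (c * s + -(c * t)) := by
    rw [← pderiv_space_kirchhoff]
    funext x
    exact pderiv_space_comp_affine hK _ _ _ _ _
  simp only [lawForm, h4, h5, inner_smul_right, inner_zero_left, add_zero] at hlaw
  simp only [h3, h1]
  rw [← hlaw, h2, inner_zero_right]
  ring

/-- A test function placed in the g component spreads only into B and g, where the source is zero;
the initial term vanishes because `div B₀ = 0`. -/
lemma duhamel_magnetic_eq_zero (c : ℝ) (hρ : Continuous ρ) (hj : Continuous j)
    (hB₀ : HasDiv B₀ fun _ => 0) (t : ℝ) :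
    duhamel maxwellMat c (state (E₀, B₀)) (fun s => source c (ρ s) (j s)) t
      (Sum.inr (Sum.inr ())) = 0 := by
  refine eq_zero_of_inner_test_eq_zero fun ψ => ?_
  rw [← inner_testH_single, inner_duhamel_testH isClifford_maxwellMat c _
    (continuous_source c hρ hj), inner_state_flow_magnetic, hB₀.sum_inner_kirchhoff]
  simp [inner_source_flow_magnetic]

lemma state_ofCoords (V : H Idx) (hf : V (Sum.inr (Sum.inl ())) = 0)
    (hg : V (Sum.inr (Sum.inr ())) = 0) :
    state (ofCoords fun i => V (Sum.inl (Sum.inl i)), ofCoords fun i => V (Sum.inl (Sum.inr i)))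
      = V := by
  ext1 k
  rcases k with (k | k) | (k | k)
  · exact coord_ofCoords _ k
  · exact coord_ofCoords _ k
  · exact hf.symm
  · exact hg.symm

end Cauchy

/-! ### Existence, uniqueness, energy and the representation formula -/

section Solution

variable {c : ℝ} {E₀ B₀ : L2V} {ρ : C(ℝ, L2)} {j : C(ℝ, L2V)} {u : C(ℝ, L2V × L2V)}

/-- Duhamel's solution has vanishing auxiliary components, hence is the state of a pair of fields,
to which `equations_iff` applies. -/
lemma exists_isSolution (hc : 0 < c) (hE₀ : HasDiv E₀ fun x => 4 * Real.pi * ρ 0 x)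
    (hB₀ : HasDiv B₀ fun _ => 0) (hcont : ChargeContinuity ρ j) :
    ∃ u, IsSolution c E₀ B₀ ρ j u := by
  have hS := continuous_source c ρ.continuous j.continuous
  let V := duhamel maxwellMat c (state (E₀, B₀)) fun s => source c (ρ s) (j s)
  have hV : Continuous V := continuous_duhamel isClifford_maxwellMat c _ hS
  let u : C(ℝ, L2V × L2V) :=
    ⟨fun t => (ofCoords fun i => V t (Sum.inl (Sum.inl i)),
      ofCoords fun i => V t (Sum.inl (Sum.inr i))),
      (continuous_ofCoords fun i => continuous_coord hV _).prodMk
        (continuous_ofCoords fun i => continuous_coord hV _)⟩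
  have hu : (fun t => state (u t)) = V := by
    funext t
    exact state_ofCoords (V t)
      (duhamel_charge_eq_zero c ρ.continuous j.continuous hE₀ hcont t)
      (duhamel_magnetic_eq_zero c ρ.continuous j.continuous hB₀ t)
  refine ⟨u, (equations_iff hc ρ.continuous j.continuous u.continuous).2 ?_, ?_⟩
  · rw [hu]
    exact isWeakSolution_duhamel isClifford_maxwellMat c _ hS
  · exact state_injective ((congrFun hu 0).trans (duhamel_zero isClifford_maxwellMat c _ _))

lemma IsSolution.isWeakSolution (h : IsSolution c E₀ B₀ ρ j u) (hc : 0 < c) :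
    IsWeakSolution maxwellMat c (fun t => state (u t)) fun t => source c (ρ t) (j t) :=
  (equations_iff hc ρ.continuous j.continuous u.continuous).1 h.equations

lemma IsSolution.state_eq_duhamel (h : IsSolution c E₀ B₀ ρ j u) (hc : 0 < c) (t : ℝ) :
    state (u t)
      = duhamel maxwellMat c (state (E₀, B₀)) (fun s => source c (ρ s) (j s)) t := by
  rw [← h.initial]
  exact (h.isWeakSolution hc).eq_duhamel isClifford_maxwellMat (continuous_state u.continuous)
    (continuous_source c ρ.continuous j.continuous) t

lemma IsSolution.unique {v : C(ℝ, L2V × L2V)} (hu : IsSolution c E₀ B₀ ρ j u)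
    (hv : IsSolution c E₀ B₀ ρ j v) (hc : 0 < c) : u = v := by
  ext1 t
  exact state_injective ((hu.state_eq_duhamel hc t).trans (hv.state_eq_duhamel hc t).symm)

/-- Conservation of energy. -/
lemma IsSolution.integral_norm_sq (h : IsSolution c E₀ B₀ ρ j u) (hc : 0 < c)
    (hj : ∀ t, j t = 0) (t : ℝ) :
    ∫ x, (‖(u t).1 x‖ ^ 2 + ‖(u t).2 x‖ ^ 2) = ∫ x, (‖E₀ x‖ ^ 2 + ‖B₀ x‖ ^ 2) := by
  have hd (t : ℝ) : HasDerivAt (fun t => ‖state (u t)‖ ^ 2) 0 t := by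
    have := hasDerivAt_norm_sq_duhamel isClifford_maxwellMat c (state (E₀, B₀))
      (continuous_source c ρ.continuous j.continuous) t
    simp only [← h.state_eq_duhamel hc] at this
    refine this.congr_deriv ?_
    -- Without current the source has only an f component, where the state is zero; a nonzero charge
    -- density does no work.
    have h0 : inner ℝ (state (u t)) (source c (ρ t) (j t)) = 0 := by
      rw [PiLp.inner_apply]
      simp [Fintype.sum_sum_type, state, source, hj]
    rw [h0, mul_zero]
  have := is_const_of_deriv_eq_zero (fun t => (hd t).differentiableAt) (fun t => (hd t).deriv) t 0
  rw [← norm_sq_state, this, h.initial, norm_sq_state]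

lemma continuous_inner_source_flow (c t : ℝ) (Φ : Idx → Test) :
    Continuous fun s => inner ℝ (source c (ρ s) (j s))
      (toH fun l => flow maxwellMat c Φ l (s - t)) := by
  refine (continuous_source c ρ.continuous j.continuous).inner ?_
  have := (continuous_toH fun l => isTestCurve_flow (A := maxwellMat) c Φ l).comp
    (continuous_sub_right t)
  exact this

lemma matConv_G_eq (hc : 0 < c) (t s : ℝ) (i : Fin 3 ⊕ Fin 3) (φ : Test) :
    matConv (G c (t - s)) (sourceVec c (ρ s) (j s)) i φ
      = (4 * Real.pi)⁻¹ * inner ℝ (source c (ρ s) (j s))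
        (toH fun l => flow maxwellMat c (Pi.single (Sum.inl i) φ) l (s - t)) := by
  have h := matConv_G hc (t - s) (ρ s) (j s) i φ
  rw [neg_sub] at h
  rw [← h, inv_mul_cancel_left₀ (by positivity)]

lemma intervalIntegrable_matConv_G (hc : 0 < c) (t : ℝ) (i : Fin 3 ⊕ Fin 3) (φ : Test) :
    IntervalIntegrable (fun s => matConv (G c (t - s)) (sourceVec c (ρ s) (j s)) i φ)
      volume 0 t := by
  simp only [matConv_G_eq hc]
  exact ((continuous_inner_source_flow c t _).const_mul _).intervalIntegrable 0 t

/-- This is `IsWeakSolution.inner_testH` for a test tuple with one nonzero entry: the initial term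
is the convolution with `M`, the source term the one with `G`. -/
lemma IsSolution.integral_fieldVec (h : IsSolution c E₀ B₀ ρ j u) (hc : 0 < c) (t : ℝ)
    (i : Fin 3 ⊕ Fin 3) (φ : Test) :
    ∫ x, fieldVec (u t) i x * φ x = matConv (M c t) (fieldVec (E₀, B₀)) i φ
      + 4 * Real.pi * ∫ s in (0 : ℝ)..t,
        matConv (G c (t - s)) (sourceVec c (ρ s) (j s)) i φ := by
  have h1 := (h.isWeakSolution hc).inner_testH isClifford_maxwellMat
    (continuous_state u.continuous) (continuous_source c ρ.continuous j.continuous)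
    (Pi.single (Sum.inl i) φ) t
  rw [h.initial, ← matConv_M, inner_testH_single] at h1
  have h2 : inner ℝ (state (u t) (Sum.inl i)) (toL2 φ) = ∫ x, fieldVec (u t) i x * φ x := by
    rcases i with i | i
    · exact inner_coord i (u t).1 (memLp_test φ)
    · exact inner_coord i (u t).2 (memLp_test φ)
  simp only [matConv_G_eq hc, intervalIntegral.integral_const_mul]
  rw [mul_inv_cancel_left₀ (by positivity), ← h2, h1]

end Solution

end

end Maxwell

end

theorem mainTheorem10 (c : ℝ) (hc : 0 < c)
    (E₀ B₀ : Maxwell.L2V) (ρ : C(ℝ, Maxwell.L2)) (j : C(ℝ, Maxwell.L2V))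
    (hE₀ : Maxwell.HasDiv E₀ (fun x => 4 * Real.pi * ρ 0 x))
    (hB₀ : Maxwell.HasDiv B₀ (fun _ => 0))
    (hcont : Maxwell.ChargeContinuity ρ j) :
    -- i) existence and uniqueness
    (∃! u : C(ℝ, Maxwell.L2V × Maxwell.L2V), Maxwell.IsSolution c E₀ B₀ ρ j u) ∧
    -- ii) conservation of energy
    ((∀ t, j t = 0) → ∀ u, Maxwell.IsSolution c E₀ B₀ ρ j u →
      ∀ t, ∫ x, (‖(u t).1 x‖ ^ 2 + ‖(u t).2 x‖ ^ 2) = ∫ x, (‖E₀ x‖ ^ 2 + ‖B₀ x‖ ^ 2)) ∧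
    -- iii) the Kirchhoff kernel is weakly differentiable in time,
    (∀ t φ, HasDerivAt (fun τ => Maxwell.K τ φ) (Maxwell.timeDeriv Maxwell.K t φ) t) ∧
    -- the kernels are concentrated on the sphere `|x| = c|t|`,
    (∀ t i k, Distribution.IsVanishingOn (Maxwell.M c t i k)
      (Metric.sphere (0 : Maxwell.Space) (c * |t|))ᶜ) ∧
    (∀ t i k, Distribution.IsVanishingOn (Maxwell.G c t i k)
      (Metric.sphere (0 : Maxwell.Space) (c * |t|))ᶜ) ∧
    -- and the convolution representation holds
    (∀ u, Maxwell.IsSolution c E₀ B₀ ρ j u → ∀ (t : ℝ) (i : Fin 3 ⊕ Fin 3) (φ : Maxwell.Test),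
      IntervalIntegrable (fun s => Maxwell.matConv (Maxwell.G c (t - s))
        (Maxwell.sourceVec c (ρ s) (j s)) i φ) volume 0 t ∧
      ∫ x, Maxwell.fieldVec (u t) i x * φ x =
        Maxwell.matConv (Maxwell.M c t) (Maxwell.fieldVec (E₀, B₀)) i φ +
          4 * Real.pi * ∫ s in (0 : ℝ)..t, Maxwell.matConv (Maxwell.G c (t - s))
            (Maxwell.sourceVec c (ρ s) (j s)) i φ) := by
  refine ⟨?_, fun hj u hu => hu.integral_norm_sq hc hj, fun t φ => Maxwell.hasDerivAt_K t φ,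
    Maxwell.M_isVanishingOn hc, Maxwell.G_isVanishingOn hc, fun u hu t i φ =>
      ⟨Maxwell.intervalIntegrable_matConv_G hc t i φ, hu.integral_fieldVec hc t i φ⟩⟩
  obtain ⟨u, hu⟩ := Maxwell.exists_isSolution hc hE₀ hB₀ hcont
  exact ⟨u, hu, fun v hv => hv.unique hu hc⟩
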